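/- Let $\mathbb{C}$ be a category with \emph{local products}, i.e. with pullbacks of split epimorphisms along split epimorphisms (a canonical choice being fixed). A \emph{local product} is a diagram $A \underset{p_1}{\overset{e_1}{\rightleftarrows}} E \underset{e_2}{\overset{p_2}{\rightleftarrows}} C$ for which there are $f\colon A\to B$, $r\colon B\to A$, $g\colon C\to B$, $s\colon B\to C$ with $fr=1_B=gs$ such that $(E,p_1,p_2)$ is the pullback of $g$ along $f$, $e_1=\langle 1_A,sf\rangle$ and $e_2=\langle rg,1_C\rangle$. It is a \emph{local coproduct} if $(e_1,e_2)$ is moreover the pushout of $(r,s)$. All spans $(D,d,c)$, $d\colon D\to D_0$, $c\colon D\to D_1$, are spans for which the kernel pairs $D(d)$, $D(c)$ of $d$ and $c$ exist. Let $\mathcal{M}_0$ be the class of all of them, $\mathcal{M}_1$ the class of those with $(d,c)$ jointly monic, and $\mathcal{M}_2$ the class of those with $(d,c)$ jointly strongly monic, that is, orthogonal to all jointly epimorphic pairs: for every jointly epimorphic pair $e_i\colon X_i\to Y$ $(i=1,2)$ and all $f_i\colon X_i\to D$, $g_0\colon Y\to D_0$, $g_1\colon Y\to D_1$ with $df_i=g_0e_i$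 and $cf_i=g_1e_i$ there is a unique $m\colon Y\to D$ with $me_i=f_i$, $dm=g_0$, $cm=g_1$ (in the presence of binary products and equalizers: $\langle d,c\rangle$ is a strong monomorphism). For a class $\mathcal{M}$ of spans consider the following categories; the morphisms are the evident ones, preserving all of the structure. \begin{itemize} \item $\mathbf{Span}(\mathbb{C},\mathcal{M})$: the spans in $\mathcal{M}$. \item $\mathbf{RG}(\mathbb{C},\mathcal{M})$: the reflexive graphs $(C_1,C_0,d,e,c)$, $de=1_{C_0}=ce$, with $(C_1,d,c)\in\mathcal{M}$. \item $\mathbf{UMG}(\mathbb{C},\mathcal{M})$: such reflexive graphs with a multiplication $m\colon C_2\to C_1$ on the pullback $C_2$ of $c$ along $d$ (with projections $\pi_1,\pi_2$, $d\pi_1=c\pi_2$) such that $dm=d\pi_2$, $cm=c\pi_1$, $m\langle 1,ed\rangle=1=m\langle ec,1\rangle$. \item $\mathbf{Cat}(\mathbb{C},\mathcal{M})$, $\mathbf{Grpd}(\mathbb{C},\mathcal{M})$: the full subcategories of those with $m$ associative, respectively with $m$ associative and with inverses. \item $\mathbf{PreGrpd}(\mathbb{C},\mathcal{M})$: the spans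 in $\mathcal{M}$ with a morphism $p\colon D(d,c)\to D$ from the object $D(d,c)=D(d)\times_D D(c)$ of triples $(x,y,z)$ with $dx=dy$, $cy=cz$, such that $p(x,y,y)=x$, $p(y,y,z)=z$, $dp(x,y,z)=dz$, $cp(x,y,z)=cx$. \item $\mathbf{DiKite}(\mathbb{C},\mathcal{M})$: the directed kites, i.e. data $f,r,g,s$ as above, a span $(D,d,c)\in\mathcal{M}$ and $\alpha\colon A\to D$, $\beta\colon B\to D$, $\gamma\colon C\to D$ with $\alpha r=\beta=\gamma s$, $d\alpha=d\beta f$, $c\gamma=c\beta g$. \item $\mathbf{MKite}(\mathbb{C},\mathcal{M})$: the directed kites with a morphism $m\colon A\times_BC\to D$ such that $dm=d\gamma\pi_2$, $cm=c\alpha\pi_1$, $me_1=\alpha$, $me_2=\gamma$. \end{itemize} Write $\mathbf{RG}(\mathbb{C})$, $\mathbf{Grpd}(\mathbb{C})$ when no class is imposed. Let $U(\mathcal{M})$ be the following list of eleven conditions. (i)--(x): each of the five forgetful functors $\mathbf{Grpd}(\mathbb{C},\mathcal{M})\to\mathbf{RG}(\mathbb{C},\mathcal{M})$, $\mathbf{Cat}(\mathbb{C},\mathcal{M})\to\mathbf{RG}(\mathbb{C},\mathcal{M})$,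 $\mathbf{UMG}(\mathbb{C},\mathcal{M})\to\mathbf{RG}(\mathbb{C},\mathcal{M})$, $\mathbf{PreGrpd}(\mathbb{C},\mathcal{M})\to\mathbf{Span}(\mathbb{C},\mathcal{M})$, $\mathbf{MKite}(\mathbb{C},\mathcal{M})\to\mathbf{DiKite}(\mathbb{C},\mathcal{M})$ is an isomorphism of categories (five conditions), respectively has a section (five conditions). (xi): for all spans $(E,p_1\colon E\to A,p_2\colon E\to C)$ and $(D,d,c)$ in $\mathcal{M}$ with $(p_1,p_2)$ jointly monic and all $e_1\colon A\to E$, $e_2\colon C\to E$, $\alpha\colon A\to D$, $\beta\colon E\to D$, $\gamma\colon C\to D$ with $p_1e_1=1_A$, $p_2e_2=1_C$, $e_1p_1e_2p_2=e_2p_2e_1p_1$, $\alpha p_1e_2p_2=\beta=\gamma p_2e_1p_1$, $d\alpha p_1=d\alpha p_1e_2p_2$, $c\gamma p_2=c\gamma p_2e_1p_1$, there is a unique $m\colon E\to D$ with $me_1=\alpha$, $me_2=\gamma$, $dm=d\gamma p_2$, $cm=c\alpha p_1$. Then: \begin{enumerate} \item Let $\mathbb{C}$ be called of naturally Mal'tsev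 type if the Lawvere condition holds: the forgetful functor $\mathbf{Grpd}(\mathbb{C})\to\mathbf{RG}(\mathbb{C})$ is an isomorphism. This condition and the eleven conditions $U(\mathcal{M}_0)$ are all equivalent. If $\mathbb{C}$ has binary products and a terminal object, they are equivalent to the existence of a canonical Mal'tsev operation on every object: a family $p_D\colon D\times D\times D\to D$, natural in $D$, with $p_D\langle x,y,y\rangle=x$ and $p_D\langle x,x,y\rangle=y$ for all $x,y\colon Z\to D$. If pushouts of split monomorphisms along split monomorphisms exist, they are equivalent to every local product being a local coproduct. \item Let $\mathbb{C}$ be called of Mal'tsev type if every reflexive relation (reflexive graph with $(d,c)$ jointly monic) is symmetric, i.e. there is $i\colon C_1\to C_1$ with $di=c$, $ci=d$. This condition and the eleven conditions $U(\mathcal{M}_1)$ are all equivalent, and they are equivalent to every local product being extremal: for every local product as above, every $(D,d,c)\in\mathcal{M}_1$ and all $\alpha\colon A\to D$, $\gamma\colon C\to D$ with $d\alpha=d\gamma p_2e_1$ and $c\gamma=c\alpha p_1e_2$ there is a unique $m\colon E\to D$ with $dm=d\gamma p_2$, $cm=c\alpha p_1$, $me_1=\alpha$, $me_2=\gamma$.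 \item Assume that $\mathbb{C}$ has equalizers and that every composite $pk$ of an equalizer $k$ followed by a split epimorphism $p$ has a kernel pair. Let $\mathbb{C}$ be called of weakly Mal'tsev type if in every local product the pair $(e_1,e_2)$ is jointly epimorphic. This condition and the eleven conditions $U(\mathcal{M}_2)$ are all equivalent. \end{enumerate} -/

import Mathlib

open CategoryTheory CategoryTheory.Limits

universe v u v₁ u₁ v₂ u₂

noncomputable section

namespace MaltsevType

/-! ### Joint monicity, joint epicity, joint strong monicity -/

section Pairs

variable {𝒞 : Type u} [Category.{v} 𝒞]

/-- The pair `(d, c)` is jointly monic. -/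
def JointlyMonic {D D₀ D₁ : 𝒞} (d : D ⟶ D₀) (c : D ⟶ D₁) : Prop :=
  ∀ ⦃Z : 𝒞⦄ (x y : Z ⟶ D), x ≫ d = y ≫ d → x ≫ c = y ≫ c → x = y

/-- The pair `(e₁, e₂)` is jointly epic. -/
def JointlyEpic {A C E : 𝒞} (e₁ : A ⟶ E) (e₂ : C ⟶ E) : Prop :=
  ∀ ⦃Z : 𝒞⦄ (x y : E ⟶ Z), e₁ ≫ x = e₁ ≫ y → e₂ ≫ x = e₂ ≫ y → x = y

/-- The pair `(d, c)` is jointly strongly monic: it is orthogonal to all jointly epic pairs.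
Testing against the jointly epic pair `(𝟙, 𝟙)` shows that such a pair is jointly monic.
If the category has binary products and equalizers, then this says that
`⟨d, c⟩ : D ⟶ D₀ ⨯ D₁` is a strong monomorphism. -/
def JointlyStronglyMonic {D D₀ D₁ : 𝒞} (d : D ⟶ D₀) (c : D ⟶ D₁) : Prop :=
  ∀ ⦃X₁ X₂ Y : 𝒞⦄ (e₁ : X₁ ⟶ Y) (e₂ : X₂ ⟶ Y), JointlyEpic e₁ e₂ →
    ∀ (f₁ : X₁ ⟶ D) (f₂ : X₂ ⟶ D) (g₀ : Y ⟶ D₀) (g₁ : Y ⟶ D₁),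
      f₁ ≫ d = e₁ ≫ g₀ → f₁ ≫ c = e₁ ≫ g₁ → f₂ ≫ d = e₂ ≫ g₀ → f₂ ≫ c = e₂ ≫ g₁ →
      ∃! m : Y ⟶ D, e₁ ≫ m = f₁ ∧ e₂ ≫ m = f₂ ∧ m ≫ d = g₀ ∧ m ≫ c = g₁

end Pairs

/-! ### Local products -/

/-- `𝒞` has local products: pullbacks of split epimorphisms along split epimorphisms exist.
The canonical choice of such a pullback is `pullback f g`. -/
class HasLocalProducts (𝒞 : Type u) [Category.{v} 𝒞] : Prop where
  hasPullback {A B C : 𝒞} (f : A ⟶ B) (g : C ⟶ B) [IsSplitEpi f] [IsSplitEpi g] : HasPullback f g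

instance hasPullback_of_isSplitEpi {𝒞 : Type u} [Category.{v} 𝒞] [HasLocalProducts 𝒞]
    {A B C : 𝒞} (f : A ⟶ B) (g : C ⟶ B) [IsSplitEpi f] [IsSplitEpi g] : HasPullback f g :=
  HasLocalProducts.hasPullback f g

/-- A split square over `f, r, g, s` whose underlying square is a pullback, with
`e₁ = ⟨1, s f⟩` and `e₂ = ⟨r g, 1⟩` the induced morphisms into the pullback. -/
structure IsLocalProductSquare {𝒞 : Type u} [Category.{v} 𝒞] {A B C E : 𝒞}
    (f : A ⟶ B) (r : B ⟶ A) (g : C ⟶ B) (s : B ⟶ C)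
    (p₁ : E ⟶ A) (e₁ : A ⟶ E) (p₂ : E ⟶ C) (e₂ : C ⟶ E) : Prop where
  r_f : r ≫ f = 𝟙 B
  s_g : s ≫ g = 𝟙 B
  isPullback : IsPullback p₁ p₂ f g
  e₁_p₁ : e₁ ≫ p₁ = 𝟙 A
  e₁_p₂ : e₁ ≫ p₂ = f ≫ s
  e₂_p₁ : e₂ ≫ p₁ = g ≫ r
  e₂_p₂ : e₂ ≫ p₂ = 𝟙 C

/-- The diagram `A ⇄ E ⇄ C` given by `p₁, e₁, p₂, e₂` is a local product. -/
def IsLocalProduct {𝒞 : Type u} [Category.{v} 𝒞] {A C E : 𝒞}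
    (p₁ : E ⟶ A) (e₁ : A ⟶ E) (p₂ : E ⟶ C) (e₂ : C ⟶ E) : Prop :=
  ∃ (B : 𝒞) (f : A ⟶ B) (r : B ⟶ A) (g : C ⟶ B) (s : B ⟶ C),
    IsLocalProductSquare f r g s p₁ e₁ p₂ e₂

/-! ### Internal reflexive graphs -/

/-- An internal reflexive graph `(C₁, C₀, d, e, c)`. -/
structure RG (𝒞 : Type u) [Category.{v} 𝒞] where
  {C₁ : 𝒞}
  {C₀ : 𝒞}
  d : C₁ ⟶ C₀
  e : C₀ ⟶ C₁
  c : C₁ ⟶ C₀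
  e_d : e ≫ d = 𝟙 C₀
  e_c : e ≫ c = 𝟙 C₀

namespace RG

variable {𝒞 : Type u} [Category.{v} 𝒞]

instance (X : RG 𝒞) : IsSplitEpi X.d := ⟨⟨⟨X.e, X.e_d⟩⟩⟩

instance (X : RG 𝒞) : IsSplitEpi X.c := ⟨⟨⟨X.e, X.e_c⟩⟩⟩

/-- Morphisms of reflexive graphs. -/
@[ext]
structure Hom (X Y : RG 𝒞) where
  f₁ : X.C₁ ⟶ Y.C₁
  f₀ : X.C₀ ⟶ Y.C₀
  d_comm : f₁ ≫ Y.d = X.d ≫ f₀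
  c_comm : f₁ ≫ Y.c = X.c ≫ f₀
  e_comm : X.e ≫ f₁ = f₀ ≫ Y.e

instance : Category (RG 𝒞) where
  Hom := Hom
  id X := ⟨𝟙 _, 𝟙 _, by simp, by simp, by simp⟩
  comp φ ψ := ⟨φ.f₁ ≫ ψ.f₁, φ.f₀ ≫ ψ.f₀,
    by rw [Category.assoc, ψ.d_comm, ← Category.assoc, φ.d_comm, Category.assoc],
    by rw [Category.assoc, ψ.c_comm, ← Category.assoc, φ.c_comm, Category.assoc],
    by rw [← Category.assoc, φ.e_comm, Category.assoc, ψ.e_comm, Category.assoc]⟩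
  id_comp _ := Hom.ext (Category.id_comp _) (Category.id_comp _)
  comp_id _ := Hom.ext (Category.comp_id _) (Category.comp_id _)
  assoc _ _ _ := Hom.ext (Category.assoc _ _ _) (Category.assoc _ _ _)

variable [HasLocalProducts 𝒞]

/-- The object of composable pairs: the pullback of `c` along `d`. -/
abbrev C₂ (X : RG 𝒞) : 𝒞 := pullback X.d X.c

abbrev π₁ (X : RG 𝒞) : X.C₂ ⟶ X.C₁ := pullback.fst X.d X.c

abbrev π₂ (X : RG 𝒞) : X.C₂ ⟶ X.C₁ := pullback.snd X.d X.c

/-- `e₁ = ⟨1, e d⟩`. -/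
def e₁ (X : RG 𝒞) : X.C₁ ⟶ X.C₂ :=
  pullback.lift (𝟙 _) (X.d ≫ X.e) (by simp [X.e_c])

/-- `e₂ = ⟨e c, 1⟩`. -/
def e₂ (X : RG 𝒞) : X.C₁ ⟶ X.C₂ :=
  pullback.lift (X.c ≫ X.e) (𝟙 _) (by simp [X.e_d])

/-- The induced morphism `f₂ = f₁ ×_{f₀} f₁`. -/
def Hom.f₂ {X Y : RG 𝒞} (φ : Hom X Y) : X.C₂ ⟶ Y.C₂ :=
  pullback.map X.d X.c Y.d Y.c φ.f₁ φ.f₁ φ.f₀ φ.d_comm.symm φ.c_comm.symm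

end RG

/-! ### Unital multiplicative graphs, internal categories, internal groupoids -/

/-- An internal unital multiplicative graph. -/
structure UMG (𝒞 : Type u) [Category.{v} 𝒞] [HasLocalProducts 𝒞] where
  graph : RG 𝒞
  m : graph.C₂ ⟶ graph.C₁
  m_d : m ≫ graph.d = graph.π₂ ≫ graph.d
  m_c : m ≫ graph.c = graph.π₁ ≫ graph.c
  e₁_m : graph.e₁ ≫ m = 𝟙 graph.C₁
  e₂_m : graph.e₂ ≫ m = 𝟙 graph.C₁

namespace UMG

variable {𝒞 : Type u} [Category.{v} 𝒞] [HasLocalProducts 𝒞]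

/-- Morphisms of unital multiplicative graphs: the morphisms of reflexive graphs which preserve
the multiplication (`f₂` is compatible with `e₁` and `e₂` automatically). -/
@[ext]
structure Hom (X Y : UMG 𝒞) where
  toHom : X.graph ⟶ Y.graph
  m_comm : X.m ≫ RG.Hom.f₁ toHom = RG.Hom.f₂ toHom ≫ Y.m

instance : Category (UMG 𝒞) where
  Hom := Hom
  id X := ⟨𝟙 X.graph, by
    have h : RG.Hom.f₂ (𝟙 X.graph) = 𝟙 _ := pullback.map_id
    rw [h, Category.id_comp]
    exact Category.comp_id _⟩
  comp {X Y Z} φ ψ := ⟨φ.toHom ≫ ψ.toHom, by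
    have h : RG.Hom.f₂ (φ.toHom ≫ ψ.toHom) = RG.Hom.f₂ φ.toHom ≫ RG.Hom.f₂ ψ.toHom :=
      (pullback.map_comp _ _ _ _ _ _ φ.toHom.d_comm.symm φ.toHom.c_comm.symm
        ψ.toHom.d_comm.symm ψ.toHom.c_comm.symm).symm
    rw [h, Category.assoc, ← ψ.m_comm, ← Category.assoc, ← φ.m_comm, Category.assoc]
    rfl⟩
  id_comp _ := Hom.ext (Category.id_comp _)
  comp_id _ := Hom.ext (Category.comp_id _)
  assoc _ _ _ := Hom.ext (Category.assoc _ _ _)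

/-- The forgetful functor from unital multiplicative graphs to reflexive graphs. -/
def forget (𝒞 : Type u) [Category.{v} 𝒞] [HasLocalProducts 𝒞] : UMG 𝒞 ⥤ RG 𝒞 where
  obj X := X.graph
  map φ := φ.toHom

/-- The product `x y = m⟨x, y⟩` of two composable generalized elements. -/
def mul (X : UMG 𝒞) {Z : 𝒞} (x y : Z ⟶ X.graph.C₁)
    (h : x ≫ X.graph.d = y ≫ X.graph.c) : Z ⟶ X.graph.C₁ :=
  pullback.lift x y h ≫ X.m

lemma mul_d (X : UMG 𝒞) {Z : 𝒞} (x y : Z ⟶ X.graph.C₁) (h : x ≫ X.graph.d = y ≫ X.graph.c) :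
    X.mul x y h ≫ X.graph.d = y ≫ X.graph.d := by
  rw [mul, Category.assoc, X.m_d, pullback.lift_snd_assoc]

lemma mul_c (X : UMG 𝒞) {Z : 𝒞} (x y : Z ⟶ X.graph.C₁) (h : x ≫ X.graph.d = y ≫ X.graph.c) :
    X.mul x y h ≫ X.graph.c = x ≫ X.graph.c := by
  rw [mul, Category.assoc, X.m_c, pullback.lift_fst_assoc]

/-- Associativity `(x y) z = x (y z)`, for all generalized elements. -/
def IsAssociative (X : UMG 𝒞) : Prop :=
  ∀ ⦃Z : 𝒞⦄ (x y z : Z ⟶ X.graph.C₁) (hxy : x ≫ X.graph.d = y ≫ X.graph.c)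
    (hyz : y ≫ X.graph.d = z ≫ X.graph.c),
    X.mul (X.mul x y hxy) z ((X.mul_d x y hxy).trans hyz) =
      X.mul x (X.mul y z hyz) (hxy.trans (X.mul_c y z hyz).symm)

/-- Existence of inverses: `i : C₁ ⟶ C₁` with `x i(x) = 1` and `i(x) x = 1`. -/
def HasInverses (X : UMG 𝒞) : Prop :=
  ∃ (i : X.graph.C₁ ⟶ X.graph.C₁) (hd : i ≫ X.graph.d = X.graph.c)
    (hc : i ≫ X.graph.c = X.graph.d),
    X.mul (𝟙 _) i ((Category.id_comp _).trans hc.symm) = X.graph.c ≫ X.graph.e ∧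
    X.mul i (𝟙 _) (hd.trans (Category.id_comp _).symm) = X.graph.d ≫ X.graph.e

end UMG

section CatGrpd

variable (𝒞 : Type u) [Category.{v} 𝒞] [HasLocalProducts 𝒞]

/-- Internal categories, as a full subcategory of the unital multiplicative graphs. -/
def isInternalCat : ObjectProperty (UMG 𝒞) := fun X => X.IsAssociative

/-- Internal groupoids, as a full subcategory of the unital multiplicative graphs
(inverses are unique, and preserved by all internal functors). -/
def isInternalGrpd : ObjectProperty (UMG 𝒞) := fun X => X.IsAssociative ∧ X.HasInverses

abbrev InternalCat := (isInternalCat 𝒞).FullSubcategory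

abbrev InternalGrpd := (isInternalGrpd 𝒞).FullSubcategory

/-- The forgetful functor from internal categories to reflexive graphs. -/
def InternalCat.forget : InternalCat 𝒞 ⥤ RG 𝒞 := (isInternalCat 𝒞).ι ⋙ UMG.forget 𝒞

/-- The forgetful functor from internal groupoids to reflexive graphs. -/
def InternalGrpd.forget : InternalGrpd 𝒞 ⥤ RG 𝒞 := (isInternalGrpd 𝒞).ι ⋙ UMG.forget 𝒞

end CatGrpd

/-! ### Spans and the kernel pair construction -/

/-- A span `(D, d, c)` whose legs have kernel pairs. -/
structure Span (𝒞 : Type u) [Category.{v} 𝒞] where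
  {D : 𝒞}
  {D₀ : 𝒞}
  {D₁ : 𝒞}
  d : D ⟶ D₀
  c : D ⟶ D₁
  [hasKernelPair_d : HasPullback d d]
  [hasKernelPair_c : HasPullback c c]

attribute [instance] Span.hasKernelPair_d Span.hasKernelPair_c

namespace Span

variable {𝒞 : Type u} [Category.{v} 𝒞]

/-- Morphisms of spans. -/
@[ext]
structure Hom (S T : Span 𝒞) where
  h : S.D ⟶ T.D
  h₀ : S.D₀ ⟶ T.D₀
  h₁ : S.D₁ ⟶ T.D₁
  d_comm : h ≫ T.d = S.d ≫ h₀
  c_comm : h ≫ T.c = S.c ≫ h₁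

instance : Category (Span 𝒞) where
  Hom := Hom
  id S := ⟨𝟙 _, 𝟙 _, 𝟙 _, by simp, by simp⟩
  comp φ ψ := ⟨φ.h ≫ ψ.h, φ.h₀ ≫ ψ.h₀, φ.h₁ ≫ ψ.h₁,
    by rw [Category.assoc, ψ.d_comm, ← Category.assoc, φ.d_comm, Category.assoc],
    by rw [Category.assoc, ψ.c_comm, ← Category.assoc, φ.c_comm, Category.assoc]⟩
  id_comp _ := Hom.ext (Category.id_comp _) (Category.id_comp _) (Category.id_comp _)
  comp_id _ := Hom.ext (Category.comp_id _) (Category.comp_id _) (Category.comp_id _)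
  assoc _ _ _ := Hom.ext (Category.assoc _ _ _) (Category.assoc _ _ _) (Category.assoc _ _ _)

/-- The kernel pair `D(d)` of `d`, with projections `d₁, d₂`. -/
abbrev Kd (S : Span 𝒞) : 𝒞 := pullback S.d S.d

abbrev d₁ (S : Span 𝒞) : S.Kd ⟶ S.D := pullback.fst S.d S.d

abbrev d₂ (S : Span 𝒞) : S.Kd ⟶ S.D := pullback.snd S.d S.d

/-- The kernel pair `D(c)` of `c`, with projections `c₁, c₂`. -/
abbrev Kc (S : Span 𝒞) : 𝒞 := pullback S.c S.c

abbrev c₁ (S : Span 𝒞) : S.Kc ⟶ S.D := pullback.fst S.c S.c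

abbrev c₂ (S : Span 𝒞) : S.Kc ⟶ S.D := pullback.snd S.c S.c

variable [HasLocalProducts 𝒞]

/-- The object `D(d, c)` of triples `(x, y, z)` with `d x = d y` and `c y = c z`. -/
abbrev Kdc (S : Span 𝒞) : 𝒞 := pullback S.d₂ S.c₁

abbrev p₁ (S : Span 𝒞) : S.Kdc ⟶ S.Kd := pullback.fst S.d₂ S.c₁

abbrev p₂ (S : Span 𝒞) : S.Kdc ⟶ S.Kc := pullback.snd S.d₂ S.c₁

/-- `e₁(x, y) = (x, y, y)`. -/
def e₁ (S : Span 𝒞) : S.Kd ⟶ S.Kdc :=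
  pullback.lift (𝟙 _) (S.d₂ ≫ pullback.diagonal S.c) (by simp)

/-- `e₂(y, z) = (y, y, z)`. -/
def e₂ (S : Span 𝒞) : S.Kc ⟶ S.Kdc :=
  pullback.lift (S.c₁ ≫ pullback.diagonal S.d) (𝟙 _) (by simp)

/-- The morphism `h³ : D(d, c) ⟶ D'(d', c')` induced by a morphism of spans. -/
def Hom.cube {S T : Span 𝒞} (φ : Hom S T) : S.Kdc ⟶ T.Kdc :=
  pullback.map S.d₂ S.c₁ T.d₂ T.c₁
    (pullback.map S.d S.d T.d T.d φ.h φ.h φ.h₀ φ.d_comm.symm φ.d_comm.symm)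
    (pullback.map S.c S.c T.c T.c φ.h φ.h φ.h₁ φ.c_comm.symm φ.c_comm.symm)
    φ.h (pullback.lift_snd _ _ _).symm (pullback.lift_fst _ _ _).symm

end Span

/-- The span part of a reflexive graph. -/
def RG.span {𝒞 : Type u} [Category.{v} 𝒞] [HasLocalProducts 𝒞] (X : RG 𝒞) : Span 𝒞 where
  d := X.d
  c := X.c

/-! ### Pregroupoids -/

/-- A pregroupoid: a span with a pregroupoid structure `p : D(d, c) ⟶ D`. -/
structure PreGrpd (𝒞 : Type u) [Category.{v} 𝒞] [HasLocalProducts 𝒞] where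
  span : Span 𝒞
  p : span.Kdc ⟶ span.D
  e₁_p : span.e₁ ≫ p = span.d₁
  e₂_p : span.e₂ ≫ p = span.c₂
  p_d : p ≫ span.d = span.p₂ ≫ span.c₂ ≫ span.d
  p_c : p ≫ span.c = span.p₁ ≫ span.d₁ ≫ span.c

namespace PreGrpd

variable {𝒞 : Type u} [Category.{v} 𝒞] [HasLocalProducts 𝒞]

/-- Morphisms of pregroupoids: the morphisms of spans which preserve the structure `p`. -/
@[ext]
structure Hom (X Y : PreGrpd 𝒞) where
  toHom : X.span ⟶ Y.span
  p_comm : X.p ≫ Span.Hom.h toHom = Span.Hom.cube toHom ≫ Y.p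

instance : Category (PreGrpd 𝒞) where
  Hom := Hom
  id X := ⟨𝟙 X.span, by
    have h : Span.Hom.cube (𝟙 X.span) = 𝟙 _ := by
      apply pullback.hom_ext <;> apply pullback.hom_ext <;>
        simp [Span.Hom.cube, CategoryStruct.id]
    rw [h, Category.id_comp]
    exact Category.comp_id _⟩
  comp {X Y Z} φ ψ := ⟨φ.toHom ≫ ψ.toHom, by
    have h : Span.Hom.cube (φ.toHom ≫ ψ.toHom) =
        Span.Hom.cube φ.toHom ≫ Span.Hom.cube ψ.toHom := by
      apply pullback.hom_ext <;> apply pullback.hom_ext <;>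
        simp [Span.Hom.cube, CategoryStruct.comp, pullback.map, pullback.lift_fst_assoc,
          pullback.lift_snd_assoc, pullback.lift_fst, pullback.lift_snd]
    rw [h, Category.assoc, ← ψ.p_comm, ← Category.assoc, ← φ.p_comm, Category.assoc]
    rfl⟩
  id_comp _ := Hom.ext (Category.id_comp _)
  comp_id _ := Hom.ext (Category.comp_id _)
  assoc _ _ _ := Hom.ext (Category.assoc _ _ _)

/-- The forgetful functor from pregroupoids to spans. -/
def forget (𝒞 : Type u) [Category.{v} 𝒞] [HasLocalProducts 𝒞] : PreGrpd 𝒞 ⥤ Span 𝒞 where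
  obj X := X.span
  map φ := φ.toHom

end PreGrpd

/-! ### Directed kites -/

/-- A directed kite with direction the span `(D, d, c)`. -/
structure DiKite (𝒞 : Type u) [Category.{v} 𝒞] where
  span : Span 𝒞
  {A : 𝒞}
  {B : 𝒞}
  {C : 𝒞}
  f : A ⟶ B
  r : B ⟶ A
  g : C ⟶ B
  s : B ⟶ C
  α : A ⟶ span.D
  β : B ⟶ span.D
  γ : C ⟶ span.D
  r_f : r ≫ f = 𝟙 B
  s_g : s ≫ g = 𝟙 B
  r_α : r ≫ α = β
  s_γ : s ≫ γ = β
  α_d : α ≫ span.d = f ≫ β ≫ span.d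
  γ_c : γ ≫ span.c = g ≫ β ≫ span.c

namespace DiKite

variable {𝒞 : Type u} [Category.{v} 𝒞]

instance (K : DiKite 𝒞) : IsSplitEpi K.f := ⟨⟨⟨K.r, K.r_f⟩⟩⟩

instance (K : DiKite 𝒞) : IsSplitEpi K.g := ⟨⟨⟨K.s, K.s_g⟩⟩⟩

/-- Morphisms of directed kites: natural transformations between the diagrams. -/
@[ext]
structure Hom (K L : DiKite 𝒞) where
  hSpan : K.span ⟶ L.span
  hA : K.A ⟶ L.A
  hB : K.B ⟶ L.B
  hC : K.C ⟶ L.C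
  f_comm : K.f ≫ hB = hA ≫ L.f
  r_comm : K.r ≫ hA = hB ≫ L.r
  g_comm : K.g ≫ hB = hC ≫ L.g
  s_comm : K.s ≫ hC = hB ≫ L.s
  α_comm : K.α ≫ Span.Hom.h hSpan = hA ≫ L.α
  β_comm : K.β ≫ Span.Hom.h hSpan = hB ≫ L.β
  γ_comm : K.γ ≫ Span.Hom.h hSpan = hC ≫ L.γ

lemma paste {W X Y X' Y' Z' : 𝒞} {a : W ⟶ X} {b : X ⟶ Y} {k : W ⟶ X'}
    {l : X ⟶ Y'} {a' : X' ⟶ Y'} {b' : Y' ⟶ Z'} {n : Y ⟶ Z'}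
    (h : k ≫ a' = a ≫ l) (h' : l ≫ b' = b ≫ n) : k ≫ a' ≫ b' = (a ≫ b) ≫ n := by
  rw [← Category.assoc, h, Category.assoc, h', Category.assoc]

instance : Category (DiKite 𝒞) where
  Hom := Hom
  id K := ⟨𝟙 _, 𝟙 _, 𝟙 _, 𝟙 _, by simp, by simp, by simp, by simp,
    (Category.comp_id _).trans (Category.id_comp _).symm,
    (Category.comp_id _).trans (Category.id_comp _).symm,
    (Category.comp_id _).trans (Category.id_comp _).symm⟩
  comp φ ψ := ⟨φ.hSpan ≫ ψ.hSpan, φ.hA ≫ ψ.hA, φ.hB ≫ ψ.hB, φ.hC ≫ ψ.hC,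
    paste φ.f_comm ψ.f_comm, paste φ.r_comm ψ.r_comm, paste φ.g_comm ψ.g_comm,
    paste φ.s_comm ψ.s_comm, paste φ.α_comm ψ.α_comm, paste φ.β_comm ψ.β_comm,
    paste φ.γ_comm ψ.γ_comm⟩
  id_comp _ := Hom.ext (Category.id_comp _) (Category.id_comp _) (Category.id_comp _)
    (Category.id_comp _)
  comp_id _ := Hom.ext (Category.comp_id _) (Category.comp_id _) (Category.comp_id _)
    (Category.comp_id _)
  assoc _ _ _ := Hom.ext (Category.assoc _ _ _) (Category.assoc _ _ _) (Category.assoc _ _ _)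
    (Category.assoc _ _ _)

variable [HasLocalProducts 𝒞]

/-- The local product `A ×_B C` of a kite. -/
abbrev P (K : DiKite 𝒞) : 𝒞 := pullback K.f K.g

abbrev π₁ (K : DiKite 𝒞) : K.P ⟶ K.A := pullback.fst K.f K.g

abbrev π₂ (K : DiKite 𝒞) : K.P ⟶ K.C := pullback.snd K.f K.g

/-- `e₁ = ⟨1, s f⟩`. -/
def e₁ (K : DiKite 𝒞) : K.A ⟶ K.P :=
  pullback.lift (𝟙 _) (K.f ≫ K.s) (by simp [K.s_g])

/-- `e₂ = ⟨r g, 1⟩`. -/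
def e₂ (K : DiKite 𝒞) : K.C ⟶ K.P :=
  pullback.lift (K.g ≫ K.r) (𝟙 _) (by simp [K.r_f])

/-- The induced morphism `h_A ×_{h_B} h_C`. -/
def Hom.prod {K L : DiKite 𝒞} (φ : Hom K L) : K.P ⟶ L.P :=
  pullback.map K.f K.g L.f L.g φ.hA φ.hC φ.hB φ.f_comm φ.g_comm

end DiKite

/-- A multiplicative directed kite. -/
structure MKite (𝒞 : Type u) [Category.{v} 𝒞] [HasLocalProducts 𝒞] where
  kite : DiKite 𝒞
  m : kite.P ⟶ kite.span.D
  m_d : m ≫ kite.span.d = kite.π₂ ≫ kite.γ ≫ kite.span.d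
  m_c : m ≫ kite.span.c = kite.π₁ ≫ kite.α ≫ kite.span.c
  e₁_m : kite.e₁ ≫ m = kite.α
  e₂_m : kite.e₂ ≫ m = kite.γ

namespace MKite

variable {𝒞 : Type u} [Category.{v} 𝒞] [HasLocalProducts 𝒞]

/-- Morphisms of multiplicative directed kites: the morphisms of directed kites which preserve
the multiplication. -/
@[ext]
structure Hom (X Y : MKite 𝒞) where
  toHom : X.kite ⟶ Y.kite
  m_comm : X.m ≫ Span.Hom.h (DiKite.Hom.hSpan toHom) = DiKite.Hom.prod toHom ≫ Y.m

instance : Category (MKite 𝒞) where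
  Hom := Hom
  id X := ⟨𝟙 X.kite, by
    have h : DiKite.Hom.prod (𝟙 X.kite) = 𝟙 _ := pullback.map_id
    rw [h, Category.id_comp]
    exact Category.comp_id _⟩
  comp {X Y Z} φ ψ := ⟨φ.toHom ≫ ψ.toHom, by
    have h : DiKite.Hom.prod (φ.toHom ≫ ψ.toHom) =
        DiKite.Hom.prod φ.toHom ≫ DiKite.Hom.prod ψ.toHom :=
      (pullback.map_comp _ _ _ _ _ _ φ.toHom.f_comm φ.toHom.g_comm
        ψ.toHom.f_comm ψ.toHom.g_comm).symm
    rw [h, Category.assoc, ← ψ.m_comm, ← Category.assoc, ← φ.m_comm, Category.assoc]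
    rfl⟩
  id_comp _ := Hom.ext (Category.id_comp _)
  comp_id _ := Hom.ext (Category.comp_id _)
  assoc _ _ _ := Hom.ext (Category.assoc _ _ _)

/-- The forgetful functor from multiplicative directed kites to directed kites. -/
def forget (𝒞 : Type u) [Category.{v} 𝒞] [HasLocalProducts 𝒞] : MKite 𝒞 ⥤ DiKite 𝒞 where
  obj X := X.kite
  map φ := φ.toHom

end MKite

/-! ### The conditions of the Unification Theorem for a class of spans -/

section Functors

variable {𝒳 : Type u₁} [Category.{v₁} 𝒳] {𝒴 : Type u₂} [Category.{v₂} 𝒴]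

/-- `F` is an isomorphism of categories. -/
def IsIsoOfCategories (F : 𝒳 ⥤ 𝒴) : Prop :=
  ∃ G : 𝒴 ⥤ 𝒳, F ⋙ G = 𝟭 𝒳 ∧ G ⋙ F = 𝟭 𝒴

/-- `F` has a section. -/
def HasSection (F : 𝒳 ⥤ 𝒴) : Prop :=
  ∃ G : 𝒴 ⥤ 𝒳, G ⋙ F = 𝟭 𝒴

/-- The restriction of `F` to the full subcategory given by `P` and its preimage. -/
def restrict (F : 𝒳 ⥤ 𝒴) (P : ObjectProperty 𝒴) :
    (P.inverseImage F).FullSubcategory ⥤ P.FullSubcategory :=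
  P.lift ((P.inverseImage F).ι ⋙ F) (fun X => X.property)

end Functors

section Conditions

variable {𝒞 : Type u} [Category.{v} 𝒞]

/-- The Kite Condition relative to `M`. -/
def KiteCondition (M : ObjectProperty (Span 𝒞)) : Prop :=
  ∀ (E S : Span 𝒞), M E → M S → JointlyMonic E.d E.c →
    ∀ (e₁ : E.D₀ ⟶ E.D) (e₂ : E.D₁ ⟶ E.D) (α : E.D₀ ⟶ S.D) (β : E.D ⟶ S.D) (γ : E.D₁ ⟶ S.D),
      e₁ ≫ E.d = 𝟙 _ → e₂ ≫ E.c = 𝟙 _ →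
      (E.c ≫ e₂) ≫ (E.d ≫ e₁) = (E.d ≫ e₁) ≫ (E.c ≫ e₂) →
      (E.c ≫ e₂ ≫ E.d) ≫ α = β → (E.d ≫ e₁ ≫ E.c) ≫ γ = β →
      E.d ≫ α ≫ S.d = (E.c ≫ e₂ ≫ E.d) ≫ α ≫ S.d →
      E.c ≫ γ ≫ S.c = (E.d ≫ e₁ ≫ E.c) ≫ γ ≫ S.c →
      ∃! m : E.D ⟶ S.D, e₁ ≫ m = α ∧ e₂ ≫ m = γ ∧
        m ≫ S.d = E.c ≫ γ ≫ S.d ∧ m ≫ S.c = E.d ≫ α ≫ S.c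

variable [HasLocalProducts 𝒞]

/-- The reflexive graphs whose span part is in `M`. -/
def graphsIn (M : ObjectProperty (Span 𝒞)) : ObjectProperty (RG 𝒞) := fun X => M X.span

/-- The directed kites whose direction is in `M`. -/
def kitesIn (M : ObjectProperty (Span 𝒞)) : ObjectProperty (DiKite 𝒞) := fun K => M K.span

/-- The eleven conditions of the Unification Theorem, for the class of spans `M`. -/
def unificationConditions (M : ObjectProperty (Span 𝒞)) : List Prop :=
  [IsIsoOfCategories (restrict (InternalGrpd.forget 𝒞) (graphsIn M)),
   HasSection (restrict (InternalGrpd.forget 𝒞) (graphsIn M)),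
   IsIsoOfCategories (restrict (InternalCat.forget 𝒞) (graphsIn M)),
   HasSection (restrict (InternalCat.forget 𝒞) (graphsIn M)),
   IsIsoOfCategories (restrict (UMG.forget 𝒞) (graphsIn M)),
   HasSection (restrict (UMG.forget 𝒞) (graphsIn M)),
   IsIsoOfCategories (restrict (PreGrpd.forget 𝒞) M),
   HasSection (restrict (PreGrpd.forget 𝒞) M),
   IsIsoOfCategories (restrict (MKite.forget 𝒞) (kitesIn M)),
   HasSection (restrict (MKite.forget 𝒞) (kitesIn M)),
   KiteCondition M]

end Conditions

/-! ### The three classes of spans and the three notions -/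

section Notions

variable (𝒞 : Type u) [Category.{v} 𝒞]

/-- All spans whose legs have kernel pairs. -/
def M₀ : ObjectProperty (Span 𝒞) := fun _ => True

/-- The jointly monic spans whose legs have kernel pairs. -/
def M₁ : ObjectProperty (Span 𝒞) := fun S => JointlyMonic S.d S.c

/-- The jointly strongly monic spans whose legs have kernel pairs. -/
def M₂ : ObjectProperty (Span 𝒞) := fun S => JointlyStronglyMonic S.d S.c

/-- Naturally Mal'tsev type, i.e. the Lawvere condition: the forgetful functor from internal
groupoids to reflexive graphs is an isomorphism. -/
def IsNaturallyMaltsev [HasLocalProducts 𝒞] : Prop :=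
  IsIsoOfCategories (InternalGrpd.forget 𝒞)

/-- Mal'tsev type: every reflexive relation is symmetric. -/
def IsMaltsev : Prop :=
  ∀ X : RG 𝒞, JointlyMonic X.d X.c → ∃ i : X.C₁ ⟶ X.C₁, i ≫ X.d = X.c ∧ i ≫ X.c = X.d

/-- Weakly Mal'tsev type: in every local product, the pair `(e₁, e₂)` is jointly epic. -/
def IsWeaklyMaltsev : Prop :=
  ∀ ⦃A C E : 𝒞⦄ (p₁ : E ⟶ A) (e₁ : A ⟶ E) (p₂ : E ⟶ C) (e₂ : C ⟶ E),
    IsLocalProduct p₁ e₁ p₂ e₂ → JointlyEpic e₁ e₂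

/-- Every local product is a local coproduct. -/
def LocalProductsAreLocalCoproducts : Prop :=
  ∀ ⦃A B C E : 𝒞⦄ (f : A ⟶ B) (r : B ⟶ A) (g : C ⟶ B) (s : B ⟶ C)
    (p₁ : E ⟶ A) (e₁ : A ⟶ E) (p₂ : E ⟶ C) (e₂ : C ⟶ E),
    IsLocalProductSquare f r g s p₁ e₁ p₂ e₂ → IsPushout r s e₁ e₂

/-- The local product given by `p₁, e₁, p₂, e₂` is extremal. -/
def IsExtremal {𝒞 : Type u} [Category.{v} 𝒞] {A C E : 𝒞}
    (p₁ : E ⟶ A) (e₁ : A ⟶ E) (p₂ : E ⟶ C) (e₂ : C ⟶ E) : Prop :=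
  ∀ S : Span 𝒞, M₁ 𝒞 S → ∀ (α : A ⟶ S.D) (γ : C ⟶ S.D),
    α ≫ S.d = e₁ ≫ p₂ ≫ γ ≫ S.d → γ ≫ S.c = e₂ ≫ p₁ ≫ α ≫ S.c →
    ∃! m : E ⟶ S.D, m ≫ S.d = p₂ ≫ γ ≫ S.d ∧ m ≫ S.c = p₁ ≫ α ≫ S.c ∧
      e₁ ≫ m = α ∧ e₂ ≫ m = γ

/-- Every local product is extremal. -/
def LocalProductsAreExtremal : Prop :=
  ∀ ⦃A C E : 𝒞⦄ (p₁ : E ⟶ A) (e₁ : A ⟶ E) (p₂ : E ⟶ C) (e₂ : C ⟶ E),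
    IsLocalProduct p₁ e₁ p₂ e₂ → IsExtremal p₁ e₁ p₂ e₂

/-- Every object `D` admits a Mal'tsev operation `D × D × D ⟶ D`, naturally in `D`. -/
def HasNaturalMaltsevOperation [HasBinaryProducts 𝒞] : Prop :=
  ∃ p : ∀ D : 𝒞, D ⨯ (D ⨯ D) ⟶ D,
    (∀ ⦃D D' : 𝒞⦄ (h : D ⟶ D'), prod.map h (prod.map h h) ≫ p D' = p D ≫ h) ∧
    ∀ ⦃Z D : 𝒞⦄ (x y : Z ⟶ D),
      prod.lift x (prod.lift y y) ≫ p D = x ∧ prod.lift x (prod.lift x y) ≫ p D = y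

/-- Pushouts of split monomorphisms along split monomorphisms exist. -/
def HasPushoutsOfSplitMonos : Prop :=
  ∀ ⦃A B C : 𝒞⦄ (r : B ⟶ A) (s : B ⟶ C), IsSplitMono r → IsSplitMono s → HasPushout r s

/-- Every composite of a split epimorphism with an equalizer has a kernel pair. -/
def HasKernelPairsOfEqualizerSplitEpi [HasEqualizers 𝒞] : Prop :=
  ∀ ⦃E Z A : 𝒞⦄ (u v : E ⟶ Z) (p : E ⟶ A), IsSplitEpi p →
    HasPullback (equalizer.ι u v ≫ p) (equalizer.ι u v ≫ p)

end Notions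

end MaltsevType

end

universe v₃ u₃

noncomputable section

namespace MaltsevType

/-! ### Isomorphisms of categories and sections of restricted functors -/

section Functors

variable {𝒳 : Type u₁} [Category.{v₁} 𝒳] {𝒴 : Type u₂} [Category.{v₂} 𝒴]

/-! Everything is compared with one statement, `HasNaturalPregroupoids M`: the spans in `M` carry
operations p(x, y, z) preserved by all morphisms of spans. The eleven conditions are equivalent to
it whenever `M` is closed under exchanging the legs and under S ↦ `S.graph`, and contains the local
products (`IsAdequate`). The three classes of the theorem are of this kind.

The weakest of the functor conditions are the sections: they choose structures which all morphisms
preserve. Multiplications on graphs yield p, since a triple (x, y, z) gives composable arrows z → y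
→ x of `S.graph`, and p(x, y, z) is the middle component of their composite. Multiplications on
kites yield p because a pregroupoid structure is a multiplication on `Span.kite`.

The crux is that naturality forces uniqueness (`HasNaturalPregroupoids.kiteCondition`). A solution m
of the kite condition is itself a morphism of spans out of E with its legs exchanged, so it
preserves p; and there 1 = p(e₁p₁, e₂p₂e₁p₁, e₂p₂), because (p₁, p₂) is jointly monic. Hence m =
p(αp₁, β, γp₂), and this formula does define a solution. On local products this says that each kite
has exactly one multiplication (`HasUniqueKiteMul`). Uniqueness in turn makes multiplications
natural and p associative (`Span.IsPregroupoid.assoc`), and an associative p turns a reflexive graph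
into a groupoid. So all five forgetful functors are isomorphisms.

The other characterisations come from suitable spans: 1 ← D → 1 for the Mal'tsev operations, a span
on the pushout of (r, s) for local coproducts, `S.graph` for the symmetry of relations, and a span
on an equalizer for the weakly Mal'tsev case. -/

lemma IsIsoOfCategories.hasSection {F : 𝒳 ⥤ 𝒴} (h : IsIsoOfCategories F) : HasSection F := by
  obtain ⟨G, -, hG⟩ := h
  exact ⟨G, hG⟩

/-- A fully faithful functor which is bijective on objects is an isomorphism of categories. -/
lemma isIsoOfCategories_of_bijective (F : 𝒳 ⥤ 𝒴) [F.Full] [F.Faithful]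
    (h : Function.Bijective F.obj) : IsIsoOfCategories F := by
  choose o ho using h.2
  let G : 𝒴 ⥤ 𝒳 :=
    { obj := o
      map := fun {y y'} φ => F.preimage (eqToHom (ho y) ≫ φ ≫ eqToHom (ho y').symm)
      map_id := fun y => F.map_injective (by simp)
      map_comp := fun φ ψ => F.map_injective (by simp) }
  refine ⟨G, CategoryTheory.Functor.ext (fun x => h.1 (ho _)) fun x x' φ => ?_,
    CategoryTheory.Functor.ext ho fun y y' φ => ?_⟩
  · apply F.map_injective
    simp [G, eqToHom_map]
  · simp [G]

/-- For a functor forgetting structure, `surj` is the existence of the structure, `inj` its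
uniqueness, and `full` its preservation by all morphisms of the underlying objects. -/
lemma isIsoOfCategories_restrict (F : 𝒳 ⥤ 𝒴) [F.Faithful] (P : ObjectProperty 𝒴)
    (surj : ∀ y, P y → ∃ x, F.obj x = y)
    (inj : ∀ x x', P (F.obj x) → F.obj x = F.obj x' → x = x')
    (full : ∀ x x', P (F.obj x) → P (F.obj x') → ∀ φ : F.obj x ⟶ F.obj x', ∃ ψ, F.map ψ = φ) :
    IsIsoOfCategories (restrict F P) := by
  have : (restrict F P).Faithful := ⟨fun {x x'} φ ψ h => by
    apply ObjectProperty.hom_ext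
    apply F.map_injective
    exact congrArg (fun χ => P.ι.map χ) h⟩
  have : (restrict F P).Full := ⟨fun {x x'} φ => by
    obtain ⟨ψ, hψ⟩ := full x.obj x'.obj x.property x'.property φ.hom
    exact ⟨ObjectProperty.homMk ψ, ObjectProperty.hom_ext _ hψ⟩⟩
  apply isIsoOfCategories_of_bijective
  constructor
  · rintro ⟨x, hx⟩ ⟨x', hx'⟩ h
    obtain rfl := inj x x' hx (congrArg ObjectProperty.FullSubcategory.obj h)
    rfl
  · rintro ⟨y, hy⟩
    obtain ⟨x, rfl⟩ := surj y hy
    exact ⟨⟨x, hy⟩, rfl⟩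

lemma isIsoOfCategories_restrict_iff (F : 𝒳 ⥤ 𝒴) (P : ObjectProperty 𝒴) (hP : ∀ y, P y) :
    IsIsoOfCategories (restrict F P) ↔ IsIsoOfCategories F := by
  let J : 𝒴 ⥤ P.FullSubcategory := P.lift (𝟭 𝒴) hP
  let I : 𝒳 ⥤ (P.inverseImage F).FullSubcategory :=
    (P.inverseImage F).lift (𝟭 𝒳) (fun x => hP (F.obj x))
  constructor
  · rintro ⟨G, h, h'⟩
    refine ⟨J ⋙ G ⋙ (P.inverseImage F).ι, ?_, ?_⟩
    · exact congrArg (fun H => I ⋙ H ⋙ (P.inverseImage F).ι) h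
    · exact congrArg (fun H => J ⋙ H ⋙ P.ι) h'
  · rintro ⟨G, h, h'⟩
    refine ⟨P.ι ⋙ G ⋙ I, ?_, ?_⟩
    · exact congrArg (fun H => (P.inverseImage F).ι ⋙ H ⋙ I) h
    · exact congrArg (fun H => P.ι ⋙ H ⋙ J) h'

/-- Objects and morphisms over `P` lift along `F`, with a fixed choice of the lifts of objects. -/
def HasLifts (F : 𝒳 ⥤ 𝒴) (P : ObjectProperty 𝒴) : Prop :=
  ∃ (o : ∀ y, P y → 𝒳) (ho : ∀ y hy, F.obj (o y hy) = y),
    ∀ (y y' : 𝒴) (hy : P y) (hy' : P y') (φ : y ⟶ y'),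
      ∃ ψ : o y hy ⟶ o y' hy', F.map ψ = eqToHom (ho y hy) ≫ φ ≫ eqToHom (ho y' hy').symm

lemma HasSection.hasLifts {F : 𝒳 ⥤ 𝒴} {P : ObjectProperty 𝒴}
    (h : HasSection (restrict F P)) : HasLifts F P := by
  obtain ⟨G, hG⟩ := h
  refine ⟨fun y hy => (G.obj ⟨y, hy⟩).obj, fun y hy =>
    congrArg ObjectProperty.FullSubcategory.obj (CategoryTheory.Functor.congr_obj hG ⟨y, hy⟩),
    fun y y' hy hy' φ => ⟨(G.map (X := ⟨y, hy⟩) (Y := ⟨y', hy'⟩) (ObjectProperty.homMk φ)).hom, ?_⟩⟩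
  have := congrArg P.ι.map (CategoryTheory.Functor.congr_hom hG
    (X := ⟨y, hy⟩) (Y := ⟨y', hy'⟩) (ObjectProperty.homMk φ))
  rw [Functor.map_comp, Functor.map_comp, eqToHom_map, eqToHom_map] at this
  exact this

/-- Reduces internal categories and groupoids to unital multiplicative graphs: for a section,
associativity and inverses can be forgotten. -/
lemma HasLifts.of_comp {𝒵 : Type u₃} [Category.{v₃} 𝒵] {F : 𝒳 ⥤ 𝒴} {G : 𝒴 ⥤ 𝒵}
    {P : ObjectProperty 𝒵} (h : HasLifts (F ⋙ G) P) : HasLifts G P := by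
  obtain ⟨o, ho, H⟩ := h
  refine ⟨fun y hy => F.obj (o y hy), ho, fun y y' hy hy' φ => ?_⟩
  obtain ⟨ψ, hψ⟩ := H y y' hy hy' φ
  exact ⟨F.map ψ, hψ⟩

end Functors

instance (𝒞 : Type u) [Category.{v} 𝒞] [HasLocalProducts 𝒞] : (UMG.forget 𝒞).Faithful :=
  ⟨fun h => UMG.Hom.ext h⟩

instance (𝒞 : Type u) [Category.{v} 𝒞] [HasLocalProducts 𝒞] : (InternalCat.forget 𝒞).Faithful :=
  inferInstanceAs (((isInternalCat 𝒞).ι ⋙ UMG.forget 𝒞).Faithful)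

instance (𝒞 : Type u) [Category.{v} 𝒞] [HasLocalProducts 𝒞] : (InternalGrpd.forget 𝒞).Faithful :=
  inferInstanceAs (((isInternalGrpd 𝒞).ι ⋙ UMG.forget 𝒞).Faithful)

instance (𝒞 : Type u) [Category.{v} 𝒞] [HasLocalProducts 𝒞] : (PreGrpd.forget 𝒞).Faithful :=
  ⟨fun h => PreGrpd.Hom.ext h⟩

instance (𝒞 : Type u) [Category.{v} 𝒞] [HasLocalProducts 𝒞] : (MKite.forget 𝒞).Faithful :=
  ⟨fun h => MKite.Hom.ext h⟩

/-! ### Structures on graphs, spans and kites -/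

section Structures

variable {𝒞 : Type u} [Category.{v} 𝒞]

/-- The span with the two legs exchanged. -/
abbrev Span.swap (S : Span 𝒞) : Span 𝒞 where
  d := S.c
  c := S.d

variable [HasLocalProducts 𝒞]

/-- `m` is a unital multiplication on the reflexive graph `X`. -/
structure RG.IsMul (X : RG 𝒞) (m : X.C₂ ⟶ X.C₁) : Prop where
  m_d : m ≫ X.d = X.π₂ ≫ X.d
  m_c : m ≫ X.c = X.π₁ ≫ X.c
  e₁_m : X.e₁ ≫ m = 𝟙 X.C₁
  e₂_m : X.e₂ ≫ m = 𝟙 X.C₁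

/-- `p` is a pregroupoid structure on the span `S`. -/
structure Span.IsPregroupoid (S : Span 𝒞) (p : S.Kdc ⟶ S.D) : Prop where
  e₁_p : S.e₁ ≫ p = S.d₁
  e₂_p : S.e₂ ≫ p = S.c₂
  p_d : p ≫ S.d = S.p₂ ≫ S.c₂ ≫ S.d
  p_c : p ≫ S.c = S.p₁ ≫ S.d₁ ≫ S.c

/-- `m` is a multiplication on the directed kite `K`. -/
structure DiKite.IsMul (K : DiKite 𝒞) (m : K.P ⟶ K.span.D) : Prop where
  m_d : m ≫ K.span.d = K.π₂ ≫ K.γ ≫ K.span.d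
  m_c : m ≫ K.span.c = K.π₁ ≫ K.α ≫ K.span.c
  e₁_m : K.e₁ ≫ m = K.α
  e₂_m : K.e₂ ≫ m = K.γ

/-- The reflexive graphs in `M` carry unital multiplications, preserved by all morphisms. -/
def HasNaturalMul (M : ObjectProperty (Span 𝒞)) : Prop :=
  ∃ m : ∀ X : RG 𝒞, M X.span → (X.C₂ ⟶ X.C₁), (∀ X hX, RG.IsMul X (m X hX)) ∧
    ∀ (X Y : RG 𝒞) (hX : M X.span) (hY : M Y.span) (φ : X ⟶ Y),
      m X hX ≫ RG.Hom.f₁ φ = RG.Hom.f₂ φ ≫ m Y hY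

/-- The spans in `M` carry pregroupoid structures, preserved by all morphisms. -/
def HasNaturalPregroupoids (M : ObjectProperty (Span 𝒞)) : Prop :=
  ∃ p : ∀ S : Span 𝒞, M S → (S.Kdc ⟶ S.D), (∀ S hS, Span.IsPregroupoid S (p S hS)) ∧
    ∀ (S T : Span 𝒞) (hS : M S) (hT : M T) (φ : S ⟶ T),
      p S hS ≫ Span.Hom.h φ = Span.Hom.cube φ ≫ p T hT

/-- The directed kites in `M` carry multiplications, preserved by all morphisms. -/
def HasNaturalKiteMul (M : ObjectProperty (Span 𝒞)) : Prop :=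
  ∃ m : ∀ K : DiKite 𝒞, M K.span → (K.P ⟶ K.span.D), (∀ K hK, DiKite.IsMul K (m K hK)) ∧
    ∀ (K L : DiKite 𝒞) (hK : M K.span) (hL : M L.span) (φ : K ⟶ L),
      m K hK ≫ Span.Hom.h (DiKite.Hom.hSpan φ) = DiKite.Hom.prod φ ≫ m L hL

/-- Every directed kite in `M` carries a unique multiplication. -/
def HasUniqueKiteMul (M : ObjectProperty (Span 𝒞)) : Prop :=
  ∀ K : DiKite 𝒞, M K.span → ∃! m, K.IsMul m

variable {M : ObjectProperty (Span 𝒞)}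

lemma hasNaturalMul_of_hasLifts (h : HasLifts (UMG.forget 𝒞) (graphsIn M)) :
    HasNaturalMul M := by
  obtain ⟨o, ho, H⟩ := h
  have ho' : ∀ X hX, (o X hX).graph = X := ho
  -- The section returns a structure on a graph only equal to `X`. With `X` a variable, the equality
  -- can be substituted away before the structure is transported.
  have isMul : ∀ (U : UMG 𝒞) {X : RG 𝒞} (h : U.graph = X),
      X.IsMul (h ▸ U.m : X.C₂ ⟶ X.C₁) := by
    rintro U _ rfl
    exact ⟨U.m_d, U.m_c, U.e₁_m, U.e₂_m⟩
  have nat : ∀ (U V : UMG 𝒞) {X Y : RG 𝒞} (h : U.graph = X) (h' : V.graph = Y) (φ : X ⟶ Y)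
      (ψ : U ⟶ V), UMG.Hom.toHom ψ = eqToHom h ≫ φ ≫ eqToHom h'.symm →
      (h ▸ U.m : X.C₂ ⟶ X.C₁) ≫ RG.Hom.f₁ φ =
        RG.Hom.f₂ φ ≫ (h' ▸ V.m : Y.C₂ ⟶ Y.C₁) := by
    rintro U V _ _ rfl rfl φ ψ hψ
    obtain rfl : UMG.Hom.toHom ψ = φ := by simpa using hψ
    exact UMG.Hom.m_comm ψ
  refine ⟨fun X hX => ho' X hX ▸ (o X hX).m, fun X hX => isMul _ _, fun X Y hX hY φ => ?_⟩
  obtain ⟨ψ, hψ⟩ := H X Y hX hY φ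
  exact nat _ _ (ho' X hX) (ho' Y hY) φ ψ hψ

lemma hasNaturalPregroupoids_of_hasLifts (h : HasLifts (PreGrpd.forget 𝒞) M) :
    HasNaturalPregroupoids M := by
  obtain ⟨o, ho, H⟩ := h
  have ho' : ∀ S hS, (o S hS).span = S := ho
  have isPre : ∀ (U : PreGrpd 𝒞) {S : Span 𝒞} (h : U.span = S),
      S.IsPregroupoid (h ▸ U.p : S.Kdc ⟶ S.D) := by
    rintro U _ rfl
    exact ⟨U.e₁_p, U.e₂_p, U.p_d, U.p_c⟩
  have nat : ∀ (U V : PreGrpd 𝒞) {S T : Span 𝒞} (h : U.span = S) (h' : V.span = T) (φ : S ⟶ T)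
      (ψ : U ⟶ V), PreGrpd.Hom.toHom ψ = eqToHom h ≫ φ ≫ eqToHom h'.symm →
      (h ▸ U.p : S.Kdc ⟶ S.D) ≫ Span.Hom.h φ =
        Span.Hom.cube φ ≫ (h' ▸ V.p : T.Kdc ⟶ T.D) := by
    rintro U V _ _ rfl rfl φ ψ hψ
    obtain rfl : PreGrpd.Hom.toHom ψ = φ := by simpa using hψ
    exact PreGrpd.Hom.p_comm ψ
  refine ⟨fun S hS => ho' S hS ▸ (o S hS).p, fun S hS => isPre _ _, fun S T hS hT φ => ?_⟩
  obtain ⟨ψ, hψ⟩ := H S T hS hT φ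
  exact nat _ _ (ho' S hS) (ho' T hT) φ ψ hψ

lemma hasNaturalKiteMul_of_hasLifts (h : HasLifts (MKite.forget 𝒞) (kitesIn M)) :
    HasNaturalKiteMul M := by
  obtain ⟨o, ho, H⟩ := h
  have ho' : ∀ K hK, (o K hK).kite = K := ho
  have isMul : ∀ (U : MKite 𝒞) {K : DiKite 𝒞} (h : U.kite = K),
      K.IsMul (h ▸ U.m : K.P ⟶ K.span.D) := by
    rintro U _ rfl
    exact ⟨U.m_d, U.m_c, U.e₁_m, U.e₂_m⟩
  have nat : ∀ (U V : MKite 𝒞) {K L : DiKite 𝒞} (h : U.kite = K) (h' : V.kite = L) (φ : K ⟶ L)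
      (ψ : U ⟶ V), MKite.Hom.toHom ψ = eqToHom h ≫ φ ≫ eqToHom h'.symm →
      (h ▸ U.m : K.P ⟶ K.span.D) ≫ Span.Hom.h (DiKite.Hom.hSpan φ) =
        DiKite.Hom.prod φ ≫ (h' ▸ V.m : L.P ⟶ L.span.D) := by
    rintro U V _ _ rfl rfl φ ψ hψ
    obtain rfl : MKite.Hom.toHom ψ = φ := by simpa using hψ
    exact MKite.Hom.m_comm ψ
  refine ⟨fun K hK => ho' K hK ▸ (o K hK).m, fun K hK => isMul _ _, fun K L hK hL φ => ?_⟩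
  obtain ⟨ψ, hψ⟩ := H K L hK hL φ
  exact nat _ _ (ho' K hK) (ho' L hL) φ ψ hψ

end Structures

/-! ### Generalized elements of `D(d, c)` -/

namespace Span

variable {𝒞 : Type u} [Category.{v} 𝒞] [HasLocalProducts 𝒞] (S : Span 𝒞)

/-- The generalized element `(x, y, z)` of `D(d, c)`. -/
def triple {Z : 𝒞} (x y z : Z ⟶ S.D) (h : x ≫ S.d = y ≫ S.d) (h' : y ≫ S.c = z ≫ S.c) :
    Z ⟶ S.Kdc :=
  pullback.lift (pullback.lift x y h) (pullback.lift y z h') (by rw [pullback.lift_snd, pullback.lift_fst])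

/-- The first component `D(d, c) ⟶ D` of a triple. -/
def fst : S.Kdc ⟶ S.D := S.p₁ ≫ S.d₁

/-- The middle component `D(d, c) ⟶ D` of a triple. -/
def mid : S.Kdc ⟶ S.D := S.p₁ ≫ S.d₂

/-- The last component `D(d, c) ⟶ D` of a triple. -/
def lst : S.Kdc ⟶ S.D := S.p₂ ≫ S.c₂

lemma mid_eq : S.mid = S.p₂ ≫ S.c₁ := pullback.condition

lemma fst_d : S.fst ≫ S.d = S.mid ≫ S.d := by
  rw [fst, mid, Category.assoc, Category.assoc, pullback.condition (f := S.d)]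

lemma mid_c : S.mid ≫ S.c = S.lst ≫ S.c := by
  rw [mid_eq, lst, Category.assoc, Category.assoc, pullback.condition (f := S.c)]

section

variable {Z : 𝒞} (x y z : Z ⟶ S.D) (h : x ≫ S.d = y ≫ S.d) (h' : y ≫ S.c = z ≫ S.c)

lemma triple_fst : S.triple x y z h h' ≫ S.fst = x := by
  rw [triple, fst, pullback.lift_fst_assoc, pullback.lift_fst]

lemma triple_mid : S.triple x y z h h' ≫ S.mid = y := by
  rw [triple, mid, pullback.lift_fst_assoc, pullback.lift_snd]

lemma triple_lst : S.triple x y z h h' ≫ S.lst = z := by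
  rw [triple, lst, pullback.lift_snd_assoc, pullback.lift_snd]

lemma triple_fst_assoc {W : 𝒞} (w : S.D ⟶ W) : S.triple x y z h h' ≫ S.fst ≫ w = x ≫ w := by
  rw [← Category.assoc, triple_fst]

lemma triple_lst_assoc {W : 𝒞} (w : S.D ⟶ W) : S.triple x y z h h' ≫ S.lst ≫ w = z ≫ w := by
  rw [← Category.assoc, triple_lst]

end

variable {S} in
lemma triple_hom_ext {Z : 𝒞} {t t' : Z ⟶ S.Kdc} (h₁ : t ≫ S.fst = t' ≫ S.fst)
    (h₂ : t ≫ S.mid = t' ≫ S.mid) (h₃ : t ≫ S.lst = t' ≫ S.lst) : t = t' := by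
  apply pullback.hom_ext <;> apply pullback.hom_ext
  · simpa [fst] using h₁
  · simpa [mid] using h₂
  · simpa [mid_eq] using h₂
  · simpa [lst] using h₃

lemma comp_triple {W Z : 𝒞} (w : W ⟶ Z) (x y z : Z ⟶ S.D) (h : x ≫ S.d = y ≫ S.d)
    (h' : y ≫ S.c = z ≫ S.c) :
    w ≫ S.triple x y z h h' = S.triple (w ≫ x) (w ≫ y) (w ≫ z) (by simp [h]) (by simp [h']) := by
  apply triple_hom_ext <;> simp [triple_fst, triple_mid, triple_lst]

lemma triple_components :
    S.triple S.fst S.mid S.lst S.fst_d S.mid_c = 𝟙 _ := by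
  apply triple_hom_ext <;> simp [triple_fst, triple_mid, triple_lst]

lemma triple_cube {T : Span 𝒞} (φ : S ⟶ T) {Z : 𝒞} (x y z : Z ⟶ S.D)
    (h : x ≫ S.d = y ≫ S.d) (h' : y ≫ S.c = z ≫ S.c) :
    S.triple x y z h h' ≫ Hom.cube φ =
      T.triple (x ≫ Hom.h φ) (y ≫ Hom.h φ) (z ≫ Hom.h φ)
        (by simp only [Category.assoc, Hom.d_comm]; rw [reassoc_of% h])
        (by simp only [Category.assoc, Hom.c_comm]; rw [reassoc_of% h']) := by
  apply pullback.hom_ext <;> apply pullback.hom_ext <;>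
    simp [triple, Hom.cube, pullback.map, pullback.lift_fst, pullback.lift_snd, pullback.lift_fst_assoc,
    pullback.lift_snd_assoc]

lemma e₁_eq : S.e₁ = S.triple S.d₁ S.d₂ S.d₂ pullback.condition rfl := by
  apply pullback.hom_ext <;> apply pullback.hom_ext <;>
    simp [triple, e₁, pullback.lift_fst, pullback.lift_snd]

lemma e₂_eq : S.e₂ = S.triple S.c₁ S.c₁ S.c₂ rfl pullback.condition := by
  apply pullback.hom_ext <;> apply pullback.hom_ext <;>
    simp [triple, e₂, pullback.lift_fst, pullback.lift_snd]

namespace IsPregroupoid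

variable {S} {p : S.Kdc ⟶ S.D}

/-- The two unit laws may be tested on generalized elements; `Kd` and `Kc` no longer appear. -/
lemma of_components (p : S.Kdc ⟶ S.D)
    (h₁ : ∀ {Z : 𝒞} (x y : Z ⟶ S.D) (h : x ≫ S.d = y ≫ S.d), S.triple x y y h rfl ≫ p = x)
    (h₂ : ∀ {Z : 𝒞} (y z : Z ⟶ S.D) (h : y ≫ S.c = z ≫ S.c), S.triple y y z rfl h ≫ p = z)
    (hd : p ≫ S.d = S.lst ≫ S.d) (hc : p ≫ S.c = S.fst ≫ S.c) : S.IsPregroupoid p where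
  e₁_p := by rw [e₁_eq, h₁]
  e₂_p := by rw [e₂_eq, h₂]
  p_d := by rw [hd, lst, Category.assoc]
  p_c := by rw [hc, fst, Category.assoc]

variable (hp : S.IsPregroupoid p)
include hp

lemma right {Z : 𝒞} (x y : Z ⟶ S.D) (h : x ≫ S.d = y ≫ S.d) :
    S.triple x y y h rfl ≫ p = x := by
  have : S.triple x y y h rfl = pullback.lift x y h ≫ S.e₁ := by
    rw [e₁_eq, comp_triple]
    simp only [pullback.lift_fst, pullback.lift_snd]
  rw [this, Category.assoc, hp.e₁_p, pullback.lift_fst]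

lemma left {Z : 𝒞} (y z : Z ⟶ S.D) (h : y ≫ S.c = z ≫ S.c) :
    S.triple y y z rfl h ≫ p = z := by
  have : S.triple y y z rfl h = pullback.lift y z h ≫ S.e₂ := by
    rw [e₂_eq, comp_triple]
    simp only [pullback.lift_fst, pullback.lift_snd]
  rw [this, Category.assoc, hp.e₂_p, pullback.lift_snd]

lemma p_d' : p ≫ S.d = S.lst ≫ S.d := by rw [hp.p_d, lst, Category.assoc]

lemma p_c' : p ≫ S.c = S.fst ≫ S.c := by rw [hp.p_c, fst, Category.assoc]

lemma triple_d {Z : 𝒞} (x y z : Z ⟶ S.D) (h : x ≫ S.d = y ≫ S.d) (h' : y ≫ S.c = z ≫ S.c) :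
    (S.triple x y z h h' ≫ p) ≫ S.d = z ≫ S.d := by
  rw [Category.assoc, hp.p_d', triple_lst_assoc]

lemma triple_c {Z : 𝒞} (x y z : Z ⟶ S.D) (h : x ≫ S.d = y ≫ S.d) (h' : y ≫ S.c = z ≫ S.c) :
    (S.triple x y z h h' ≫ p) ≫ S.c = x ≫ S.c := by
  rw [Category.assoc, hp.p_c', triple_fst_assoc]

end IsPregroupoid

/-- The reflexive graph with objects the elements of `D`, in which an arrow from `x` to `z` is
an element `y` with `d x = d y` and `c y = c z`. -/
abbrev graph : RG 𝒞 where
  d := S.fst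
  e := S.triple (𝟙 _) (𝟙 _) (𝟙 _) rfl rfl
  c := S.lst
  e_d := S.triple_fst _ _ _ _ _
  e_c := S.triple_lst _ _ _ _ _

/-- The functoriality of `Span.graph`. -/
def graphMap {S T : Span 𝒞} (φ : S ⟶ T) : S.graph ⟶ T.graph where
  f₁ := Hom.cube φ
  f₀ := Hom.h φ
  d_comm := by
    change Hom.cube φ ≫ T.fst = S.fst ≫ Hom.h φ
    rw [← Category.id_comp (Hom.cube φ), ← triple_components, triple_cube, triple_fst]
  c_comm := by
    change Hom.cube φ ≫ T.lst = S.lst ≫ Hom.h φ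
    rw [← Category.id_comp (Hom.cube φ), ← triple_components, triple_cube, triple_lst]
  e_comm := by
    change S.triple _ _ _ _ _ ≫ Hom.cube φ = Hom.h φ ≫ T.triple _ _ _ _ _
    simp [triple_cube, comp_triple]

lemma cube_mid {T : Span 𝒞} (φ : S ⟶ T) : Hom.cube φ ≫ T.mid = S.mid ≫ Hom.h φ := by
  rw [← Category.id_comp (Hom.cube φ), ← triple_components, triple_cube, triple_mid]

end Span

/-! ### From unital multiplications to pregroupoid structures -/

section

variable {𝒞 : Type u} [Category.{v} 𝒞] [HasLocalProducts 𝒞]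

/-- The composable pair `(x, y)` of generalized elements. -/
def RG.pair (X : RG 𝒞) {Z : 𝒞} (x y : Z ⟶ X.C₁) (h : x ≫ X.d = y ≫ X.c) : Z ⟶ X.C₂ :=
  pullback.lift x y h

lemma RG.comp_pair (X : RG 𝒞) {W Z : 𝒞} (w : W ⟶ Z) (x y : Z ⟶ X.C₁) (h : x ≫ X.d = y ≫ X.c) :
    w ≫ X.pair x y h = X.pair (w ≫ x) (w ≫ y) (by simp [h]) := by
  apply pullback.hom_ext <;> simp [pair, pullback.lift_fst, pullback.lift_snd]

lemma RG.pair_f₂ {X Y : RG 𝒞} (φ : X ⟶ Y) {Z : 𝒞} (x y : Z ⟶ X.C₁) (h : x ≫ X.d = y ≫ X.c) :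
    X.pair x y h ≫ Hom.f₂ φ = Y.pair (x ≫ Hom.f₁ φ) (y ≫ Hom.f₁ φ)
      (by simp only [Category.assoc, Hom.d_comm, Hom.c_comm]; rw [reassoc_of% h]) := by
  apply pullback.hom_ext <;>
    simp [pair, Hom.f₂, pullback.map, pullback.lift_fst, pullback.lift_snd,
      pullback.lift_fst_assoc, pullback.lift_snd_assoc]

namespace RG.IsMul

variable {X : RG 𝒞} {m : X.C₂ ⟶ X.C₁} (hm : X.IsMul m) {Z : 𝒞} (x y : Z ⟶ X.C₁)
  (h : x ≫ X.d = y ≫ X.c)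
include hm

lemma mul_id (hy : y = x ≫ X.d ≫ X.e) : X.pair x y h ≫ m = x := by
  subst hy
  have : X.pair x (x ≫ X.d ≫ X.e) h = x ≫ X.e₁ := by
    apply pullback.hom_ext <;> simp [RG.e₁, RG.pair, pullback.lift_fst, pullback.lift_snd]
  rw [this, Category.assoc, hm.e₁_m, Category.comp_id]

lemma id_mul (hx : x = y ≫ X.c ≫ X.e) : X.pair x y h ≫ m = y := by
  subst hx
  have : X.pair (y ≫ X.c ≫ X.e) y h = y ≫ X.e₂ := by
    apply pullback.hom_ext <;> simp [RG.e₂, RG.pair, pullback.lift_fst, pullback.lift_snd]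
  rw [this, Category.assoc, hm.e₂_m, Category.comp_id]

lemma pair_d_assoc {W : 𝒞} (w : X.C₀ ⟶ W) : X.pair x y h ≫ m ≫ X.d ≫ w = y ≫ X.d ≫ w := by
  have hd := hm.m_d
  rw [reassoc_of% hd, RG.pair, pullback.lift_snd_assoc]

lemma pair_c_assoc {W : 𝒞} (w : X.C₀ ⟶ W) : X.pair x y h ≫ m ≫ X.c ≫ w = x ≫ X.c ≫ w := by
  have hc := hm.m_c
  rw [reassoc_of% hc, RG.pair, pullback.lift_fst_assoc]

end RG.IsMul

variable {M : ObjectProperty (Span 𝒞)}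

/-- The pregroupoid structure is the composite of the arrows `y : z ⟶ y` and `x : y ⟶ x`. -/
lemma HasNaturalMul.hasNaturalPregroupoids (hM : ∀ S, M S → M S.graph.span)
    (h : HasNaturalMul M) : HasNaturalPregroupoids M := by
  obtain ⟨m, hm, nat⟩ := h
  -- The arrow y → x has middle component x, and the arrow z → y has middle component z. The left
  -- factor of a product is the arrow applied last.
  let q : ∀ S : Span 𝒞, S.Kdc ⟶ S.graph.C₂ := fun S =>
    S.graph.pair (S.triple S.mid S.fst S.fst S.fst_d.symm rfl)
      (S.triple S.lst S.lst S.mid rfl S.mid_c.symm)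
      ((S.triple_fst _ _ _ _ _).trans (S.triple_lst _ _ _ _ _).symm)
  have hq : ∀ (S : Span 𝒞) {Z : 𝒞} (x y z : Z ⟶ S.D) (h : x ≫ S.d = y ≫ S.d)
      (h' : y ≫ S.c = z ≫ S.c), S.triple x y z h h' ≫ q S =
        S.graph.pair (S.triple y x x h.symm rfl) (S.triple z z y rfl h'.symm)
          ((S.triple_fst _ _ _ _ _).trans (S.triple_lst _ _ _ _ _).symm) := by
    intro S Z x y z h h'
    simp only [q, RG.comp_pair, Span.comp_triple, Span.triple_fst, Span.triple_mid,
      Span.triple_lst]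
  refine ⟨fun S hS => q S ≫ m S.graph (hM S hS) ≫ S.mid, fun S hS => ?_, ?_⟩
  · have H := hm S.graph (hM S hS)
    refine .of_components _ (fun {Z} x y h => ?_) (fun {Z} y z h => ?_) ?_ ?_
    -- For z = y the right factor (y, y, y) is an identity, so the composite is (y, x, x), with
    -- middle component x.
    · rw [reassoc_of% hq, reassoc_of% (H.mul_id _ _ _ ?_), Span.triple_mid]
      simp [Span.comp_triple, Span.triple_fst]
    · rw [reassoc_of% hq, reassoc_of% (H.id_mul _ _ _ ?_), Span.triple_mid]
      simp [Span.comp_triple, Span.triple_lst]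
    -- The composite is an arrow from z to x, so its middle component w has dw = dz; dually cw = cx.
    · rw [Category.assoc, Category.assoc, ← S.fst_d]
      exact (H.pair_d_assoc _ _ _ _).trans (Span.triple_fst_assoc _ _ _ _ _ _ _)
    · rw [Category.assoc, Category.assoc, S.mid_c]
      exact (H.pair_c_assoc _ _ _ _).trans (Span.triple_lst_assoc _ _ _ _ _ _ _)
  · intro S T hS hT φ
    have H := nat _ _ (hM S hS) (hM T hT) (Span.graphMap φ)
    have hφ : q S ≫ RG.Hom.f₂ (Span.graphMap φ) = Span.Hom.cube φ ≫ q T := by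
      rw [← Category.id_comp (Span.Hom.cube φ), ← Span.triple_components, Span.triple_cube, hq,
        RG.pair_f₂]
      simp only [Span.graphMap, Span.triple_cube]
    rw [Category.assoc, Category.assoc, ← Span.cube_mid, ← reassoc_of% hφ, ← reassoc_of% H]
    rfl

end

section

variable {𝒞 : Type u} [Category.{v} 𝒞]

/-! ### Pregroupoids and the kite condition -/

/-- A local product, as a span. -/
def IsLocalProductSquare.span [HasLocalProducts 𝒞] {A B C E : 𝒞} {f : A ⟶ B} {r : B ⟶ A}
    {g : C ⟶ B} {s : B ⟶ C} {p₁ : E ⟶ A} {e₁ : A ⟶ E} {p₂ : E ⟶ C} {e₂ : C ⟶ E}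
    (h : IsLocalProductSquare f r g s p₁ e₁ p₂ e₂) : Span 𝒞 :=
  haveI : IsSplitEpi p₁ := ⟨⟨⟨e₁, h.e₁_p₁⟩⟩⟩
  haveI : IsSplitEpi p₂ := ⟨⟨⟨e₂, h.e₂_p₂⟩⟩⟩
  { d := p₁, c := p₂ }

variable [HasLocalProducts 𝒞]

/-- The closure properties of a class of spans used in the unification of the conditions. -/
structure IsAdequate (M : ObjectProperty (Span 𝒞)) : Prop where
  swap : ∀ S, M S → M S.swap
  graph : ∀ S : Span 𝒞, M S → M S.graph.span
  localProduct : ∀ ⦃A B C E : 𝒞⦄ ⦃f : A ⟶ B⦄ ⦃r : B ⟶ A⦄ ⦃g : C ⟶ B⦄ ⦃s : B ⟶ C⦄ ⦃p₁ : E ⟶ A⦄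
    ⦃e₁ : A ⟶ E⦄ ⦃p₂ : E ⟶ C⦄ ⦃e₂ : C ⟶ E⦄ (h : IsLocalProductSquare f r g s p₁ e₁ p₂ e₂),
    M h.span

variable {M : ObjectProperty (Span 𝒞)}

/-- The required morphism is `p(α p₁, β, γ p₂)`; it is unique because of the naturality of `p`
with respect to the morphism of spans that a second such morphism defines. -/
lemma HasNaturalPregroupoids.kiteCondition (hM : ∀ S, M S → M S.swap)
    (h : HasNaturalPregroupoids M) : KiteCondition M := by
  obtain ⟨p, hp, nat⟩ := h
  intro E S hE hS hmono e₁ e₂ α β γ he₁ he₂ comm hα hγ hd hc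
  have h₁ : (E.d ≫ α) ≫ S.d = β ≫ S.d := by
    rw [Category.assoc, hd, ← hα]; simp only [Category.assoc]
  have h₂ : β ≫ S.c = (E.c ≫ γ) ≫ S.c := by
    rw [Category.assoc, hc, ← hγ]; simp only [Category.assoc]
  -- Along e₁ the last two entries of (αp₁, β, γp₂) agree, and along e₂ the first two, so the unit
  -- laws of p evaluate the candidate.
  have e₁β : e₁ ≫ β = e₁ ≫ E.c ≫ γ := by
    rw [← hγ]; simp only [Category.assoc]; rw [reassoc_of% he₁]
  have e₂β : e₂ ≫ β = e₂ ≫ E.d ≫ α := by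
    rw [← hα]; simp only [Category.assoc]; rw [reassoc_of% he₂]
  refine ⟨S.triple (E.d ≫ α) β (E.c ≫ γ) h₁ h₂ ≫ p S hS, ⟨?_, ?_, ?_, ?_⟩, ?_⟩
  · rw [← Category.assoc, Span.comp_triple]
    simp only [e₁β]
    rw [(hp S hS).right, reassoc_of% he₁]
  · rw [← Category.assoc, Span.comp_triple]
    simp only [e₂β]
    rw [(hp S hS).left, reassoc_of% he₂]
  · rw [(hp S hS).triple_d, Category.assoc]
  · rw [(hp S hS).triple_c, Category.assoc]
  · rintro m ⟨hm₁, hm₂, hmd, hmc⟩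
    -- The equations dm = dγp₂ and cm = cαp₁ pair d with p₂ and c with p₁, which is why the legs of
    -- E are exchanged.
    let φ : E.swap ⟶ S := Span.Hom.mk (S := E.swap) (T := S) m (γ ≫ S.d) (α ≫ S.c) hmd hmc
    have k₁ : (E.d ≫ e₁) ≫ E.swap.d = (E.d ≫ e₁ ≫ E.c ≫ e₂) ≫ E.swap.d := by
      change (E.d ≫ e₁) ≫ E.c = (E.d ≫ e₁ ≫ E.c ≫ e₂) ≫ E.c
      simp [he₂]
    have k₂ : (E.d ≫ e₁ ≫ E.c ≫ e₂) ≫ E.swap.c = (E.c ≫ e₂) ≫ E.swap.c := by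
      change (E.d ≫ e₁ ≫ E.c ≫ e₂) ≫ E.d = (E.c ≫ e₂) ≫ E.d
      have := comm =≫ E.d
      simp only [Category.assoc] at this ⊢
      rw [← this, he₁, Category.comp_id]
    have hE' := hM E hE
    -- Both sides have the same composites with p₁ and p₂, so joint monicity applies.
    have hone : E.swap.triple _ _ _ k₁ k₂ ≫ p E.swap hE' = 𝟙 E.D := by
      apply hmono
      · refine ((hp _ hE').triple_c _ _ _ k₁ k₂).trans ?_
        change (E.d ≫ e₁) ≫ E.d = _
        simp [he₁]
      · refine ((hp _ hE').triple_d _ _ _ k₁ k₂).trans ?_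
        change (E.c ≫ e₂) ≫ E.c = _
        simp [he₂]
    have key := nat _ _ hE' hS φ
    have key' : m = E.swap.triple _ _ _ k₁ k₂ ≫ p E.swap hE' ≫ Span.Hom.h φ := by
      rw [reassoc_of% hone]
    rw [key', key, ← Category.assoc, Span.triple_cube]
    congr 1
    have hm' : Span.Hom.h φ = m := rfl
    -- The commuting idempotents e₁p₁ and e₂p₂ let m meet e₁ first, where it is α.
    have mid : (E.d ≫ e₁ ≫ E.c ≫ e₂) ≫ m = β := by
      have := (comm =≫ m)
      simp only [Category.assoc, hm₁, hm₂] at this ⊢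
      rw [← this, ← hα]
      simp only [Category.assoc]
    apply Span.triple_hom_ext <;>
      simp only [Span.triple_fst, Span.triple_mid, Span.triple_lst, hm']
    · rw [Category.assoc, hm₁]
    · exact mid
    · rw [Category.assoc, hm₂]

/-! ### Kites -/

namespace DiKite

variable (K : DiKite 𝒞)

lemma isLocalProductSquare :
    IsLocalProductSquare K.f K.r K.g K.s K.π₁ K.e₁ K.π₂ K.e₂ where
  r_f := K.r_f
  s_g := K.s_g
  isPullback := IsPullback.of_hasPullback _ _
  e₁_p₁ := pullback.lift_fst _ _ _
  e₁_p₂ := pullback.lift_snd _ _ _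
  e₂_p₁ := pullback.lift_fst _ _ _
  e₂_p₂ := pullback.lift_snd _ _ _

end DiKite

/-- The kite condition applies to the directed kites on a local product. -/
lemma KiteCondition.existsUnique (hM : IsAdequate M) (h : KiteCondition M)
    {A B C E : 𝒞} {f : A ⟶ B} {r : B ⟶ A} {g : C ⟶ B} {s : B ⟶ C}
    {p₁ : E ⟶ A} {e₁ : A ⟶ E} {p₂ : E ⟶ C} {e₂ : C ⟶ E}
    (H : IsLocalProductSquare f r g s p₁ e₁ p₂ e₂) (S : Span 𝒞) (hS : M S)
    (α : A ⟶ S.D) (γ : C ⟶ S.D) (hβ : r ≫ α = s ≫ γ)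
    (hα : α ≫ S.d = f ≫ r ≫ α ≫ S.d) (hγ : γ ≫ S.c = g ≫ s ≫ γ ≫ S.c) :
    ∃! m : E ⟶ S.D, e₁ ≫ m = α ∧ e₂ ≫ m = γ ∧
      m ≫ S.d = p₂ ≫ γ ≫ S.d ∧ m ≫ S.c = p₁ ≫ α ≫ S.c := by
  have w := H.isPullback.w
  have a₁ := H.e₁_p₁
  have a₂ := H.e₁_p₂
  have b₁ := H.e₂_p₁
  have b₂ := H.e₂_p₂
  have sg := H.s_g
  have rf := H.r_f
  refine h H.span S (hM.localProduct H) hS (fun Z x y => H.isPullback.hom_ext) e₁ e₂ α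
    ((p₂ ≫ e₂ ≫ p₁) ≫ α) γ a₁ b₂ ?_ rfl ?_ ?_ ?_
  · change (p₂ ≫ e₂) ≫ p₁ ≫ e₁ = (p₁ ≫ e₁) ≫ p₂ ≫ e₂
    apply H.isPullback.hom_ext
    · simp only [Category.assoc, a₁, Category.comp_id]
      rw [b₁, reassoc_of% a₂, reassoc_of% sg, reassoc_of% w]
    · simp only [Category.assoc, b₂, Category.comp_id]
      rw [a₂, reassoc_of% b₁, reassoc_of% rf, reassoc_of% w]
  · change (p₁ ≫ e₁ ≫ p₂) ≫ γ = (p₂ ≫ e₂ ≫ p₁) ≫ α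
    simp only [Category.assoc]
    rw [reassoc_of% a₂, reassoc_of% b₁, hβ, reassoc_of% w]
  · change p₁ ≫ α ≫ S.d = (p₂ ≫ e₂ ≫ p₁) ≫ α ≫ S.d
    simp only [Category.assoc]
    rw [reassoc_of% b₁, hα, reassoc_of% w, reassoc_of% rf]
  · change p₂ ≫ γ ≫ S.c = (p₁ ≫ e₁ ≫ p₂) ≫ γ ≫ S.c
    simp only [Category.assoc]
    rw [reassoc_of% a₂, hγ, reassoc_of% w, reassoc_of% sg]

lemma KiteCondition.hasUniqueKiteMul (hM : IsAdequate M) (h : KiteCondition M) :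
    HasUniqueKiteMul M := by
  intro K hK
  obtain ⟨m, ⟨h₁, h₂, hd, hc⟩, uniq⟩ := h.existsUnique hM K.isLocalProductSquare K.span hK K.α K.γ
    (K.r_α.trans K.s_γ.symm) (by rw [reassoc_of% K.r_α]; exact K.α_d)
    (by rw [reassoc_of% K.s_γ]; exact K.γ_c)
  exact ⟨m, ⟨hd, hc, h₁, h₂⟩, fun m' hm' => uniq m' ⟨hm'.e₁_m, hm'.e₂_m, hm'.m_d, hm'.m_c⟩⟩

namespace DiKite

/-- The kite obtained by composing with a morphism from the direction of `K`. -/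
def push (K : DiKite 𝒞) {T : Span 𝒞} (φ : K.span ⟶ T) : DiKite 𝒞 where
  span := T
  f := K.f
  r := K.r
  g := K.g
  s := K.s
  α := K.α ≫ Span.Hom.h φ
  β := K.β ≫ Span.Hom.h φ
  γ := K.γ ≫ Span.Hom.h φ
  r_f := K.r_f
  s_g := K.s_g
  r_α := by rw [← Category.assoc, K.r_α]
  s_γ := by rw [← Category.assoc, K.s_γ]
  α_d := by
    have := K.α_d
    simp only [Category.assoc, Span.Hom.d_comm]
    rw [reassoc_of% this]
  γ_c := by
    have := K.γ_c
    simp only [Category.assoc, Span.Hom.c_comm]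
    rw [reassoc_of% this]

/-- The two sides of the naturality square of a morphism of kites are both multiplications on the
pushed kite: one is this one, the other is `IsMul.comp_prod`. Uniqueness there gives naturality. -/
lemma IsMul.push {K : DiKite 𝒞} {m : K.P ⟶ K.span.D} (hm : K.IsMul m) {T : Span 𝒞}
    (φ : K.span ⟶ T) : (K.push φ).IsMul (m ≫ Span.Hom.h φ) where
  m_d := by
    change (m ≫ Span.Hom.h φ) ≫ T.d = K.π₂ ≫ (K.γ ≫ Span.Hom.h φ) ≫ T.d
    have := hm.m_d
    simp only [Category.assoc, Span.Hom.d_comm]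
    rw [reassoc_of% this]
  m_c := by
    change (m ≫ Span.Hom.h φ) ≫ T.c = K.π₁ ≫ (K.α ≫ Span.Hom.h φ) ≫ T.c
    have := hm.m_c
    simp only [Category.assoc, Span.Hom.c_comm]
    rw [reassoc_of% this]
  e₁_m := by
    change K.e₁ ≫ m ≫ Span.Hom.h φ = K.α ≫ Span.Hom.h φ
    rw [← Category.assoc, hm.e₁_m]
  e₂_m := by
    change K.e₂ ≫ m ≫ Span.Hom.h φ = K.γ ≫ Span.Hom.h φ
    rw [← Category.assoc, hm.e₂_m]

lemma IsMul.comp_prod {K L : DiKite 𝒞} {m : L.P ⟶ L.span.D} (hm : L.IsMul m) (φ : K ⟶ L) :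
    (K.push (Hom.hSpan φ)).IsMul (Hom.prod (K := K) (L := L) φ ≫ m) where
  m_d := by
    change (Hom.prod φ ≫ m) ≫ L.span.d = K.π₂ ≫ (K.γ ≫ Span.Hom.h (Hom.hSpan φ)) ≫ L.span.d
    rw [Category.assoc, hm.m_d, Hom.γ_comm, Hom.prod, pullback.map, pullback.lift_snd_assoc]
    simp only [Category.assoc]
  m_c := by
    change (Hom.prod φ ≫ m) ≫ L.span.c = K.π₁ ≫ (K.α ≫ Span.Hom.h (Hom.hSpan φ)) ≫ L.span.c
    rw [Category.assoc, hm.m_c, Hom.α_comm, Hom.prod, pullback.map, pullback.lift_fst_assoc]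
    simp only [Category.assoc]
  e₁_m := by
    change K.e₁ ≫ Hom.prod φ ≫ m = K.α ≫ Span.Hom.h (Hom.hSpan φ)
    have : K.e₁ ≫ Hom.prod φ = Hom.hA φ ≫ L.e₁ := by
      apply pullback.hom_ext <;>
        simp [e₁, Hom.prod, pullback.map, pullback.lift_fst, pullback.lift_snd,
          pullback.lift_fst_assoc, pullback.lift_snd_assoc, Hom.s_comm]
      rw [← Category.assoc, Hom.f_comm, Category.assoc]
    rw [reassoc_of% this, hm.e₁_m, Hom.α_comm]
  e₂_m := by
    change K.e₂ ≫ Hom.prod φ ≫ m = K.γ ≫ Span.Hom.h (Hom.hSpan φ)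
    have : K.e₂ ≫ Hom.prod φ = Hom.hC φ ≫ L.e₂ := by
      apply pullback.hom_ext <;>
        simp [e₂, Hom.prod, pullback.map, pullback.lift_fst, pullback.lift_snd,
          pullback.lift_fst_assoc, pullback.lift_snd_assoc, Hom.r_comm]
      rw [← Category.assoc, Hom.g_comm, Category.assoc]
    rw [reassoc_of% this, hm.e₂_m, Hom.γ_comm]

end DiKite

/-- If multiplications are unique, then they are preserved by all morphisms of kites. -/
lemma HasUniqueKiteMul.natural (h : HasUniqueKiteMul M) {K L : DiKite 𝒞} (hL : M L.span)
    {m : K.P ⟶ K.span.D} {n : L.P ⟶ L.span.D} (hm : K.IsMul m) (hn : L.IsMul n) (φ : K ⟶ L) :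
    m ≫ Span.Hom.h (DiKite.Hom.hSpan φ) = DiKite.Hom.prod φ ≫ n :=
  (h (K.push (DiKite.Hom.hSpan φ)) hL).unique (hm.push _) (hn.comp_prod φ)

/-- The kite whose multiplications are the pregroupoid structures on `S`. -/
def Span.kite (S : Span 𝒞) : DiKite 𝒞 where
  span := S
  f := S.d₂
  r := pullback.diagonal S.d
  g := S.c₁
  s := pullback.diagonal S.c
  α := S.d₁
  β := 𝟙 _
  γ := S.c₂
  r_f := pullback.diagonal_snd _
  s_g := pullback.diagonal_fst _
  r_α := pullback.diagonal_fst _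
  s_γ := pullback.diagonal_snd _
  α_d := by rw [Category.id_comp, pullback.condition]
  γ_c := by rw [Category.id_comp, pullback.condition]

lemma Span.isMul_kite_iff (S : Span 𝒞) (p : S.Kdc ⟶ S.D) :
    DiKite.IsMul S.kite p ↔ S.IsPregroupoid p :=
  ⟨fun h => ⟨h.e₁_m, h.e₂_m, h.m_d, h.m_c⟩, fun h => ⟨h.p_d, h.p_c, h.e₁_p, h.e₂_p⟩⟩

/-- The functoriality of `Span.kite`. -/
def Span.kiteMap {S T : Span 𝒞} (φ : S ⟶ T) : S.kite ⟶ T.kite where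
  hSpan := φ
  hA := pullback.map S.d S.d T.d T.d (Hom.h φ) (Hom.h φ) (Hom.h₀ φ)
    (Hom.d_comm φ).symm (Hom.d_comm φ).symm
  hB := Hom.h φ
  hC := pullback.map S.c S.c T.c T.c (Hom.h φ) (Hom.h φ) (Hom.h₁ φ)
    (Hom.c_comm φ).symm (Hom.c_comm φ).symm
  f_comm := (pullback.lift_snd (f := T.d) (g := T.d) _ _ _).symm
  r_comm := by
    dsimp only [kite]
    apply pullback.hom_ext <;> simp [pullback.map, pullback.lift_fst, pullback.lift_snd]
  g_comm := (pullback.lift_fst (f := T.c) (g := T.c) _ _ _).symm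
  s_comm := by
    dsimp only [kite]
    apply pullback.hom_ext <;> simp [pullback.map, pullback.lift_fst, pullback.lift_snd]
  α_comm := (pullback.lift_fst (f := T.d) (g := T.d) _ _ _).symm
  β_comm := (Category.id_comp _).trans (Category.comp_id _).symm
  γ_comm := (pullback.lift_snd (f := T.c) (g := T.c) _ _ _).symm

lemma HasNaturalKiteMul.hasNaturalPregroupoids (h : HasNaturalKiteMul M) :
    HasNaturalPregroupoids M := by
  obtain ⟨m, hm, nat⟩ := h
  exact ⟨fun S hS => m S.kite hS, fun S hS => (S.isMul_kite_iff _).1 (hm S.kite hS),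
    fun S T hS hT φ => nat _ _ hS hT (Span.kiteMap φ)⟩

lemma HasUniqueKiteMul.hasNaturalKiteMul (h : HasUniqueKiteMul M) : HasNaturalKiteMul M := by
  choose m hm using fun K hK => (h K hK).exists
  exact ⟨m, hm, fun K L hK hL φ => h.natural hL (hm K hK) (hm L hL) φ⟩

/-- The kite whose multiplications are the unital multiplications on `X`. -/
def RG.kite (X : RG 𝒞) : DiKite 𝒞 where
  span := X.span
  f := X.d
  r := X.e
  g := X.c
  s := X.e
  α := 𝟙 _
  β := X.e
  γ := 𝟙 _
  r_f := X.e_d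
  s_g := X.e_c
  r_α := Category.comp_id _
  s_γ := Category.comp_id _
  α_d := by
    change 𝟙 _ ≫ X.d = X.d ≫ X.e ≫ X.d
    simp [X.e_d]
  γ_c := by
    change 𝟙 _ ≫ X.c = X.c ≫ X.e ≫ X.c
    simp [X.e_c]

lemma RG.isMul_kite_iff (X : RG 𝒞) (m : X.C₂ ⟶ X.C₁) :
    DiKite.IsMul X.kite m ↔ X.IsMul m := by
  have hd : X.π₂ ≫ 𝟙 _ ≫ X.d = X.π₂ ≫ X.d := by rw [Category.id_comp]
  have hc : X.π₁ ≫ 𝟙 _ ≫ X.c = X.π₁ ≫ X.c := by rw [Category.id_comp]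
  exact ⟨fun h => ⟨h.m_d.trans hd, h.m_c.trans hc, h.e₁_m, h.e₂_m⟩,
    fun h => ⟨h.m_d.trans hd.symm, h.m_c.trans hc.symm, h.e₁_m, h.e₂_m⟩⟩

/-- The functoriality of `RG.kite`. -/
def RG.kiteMap {X Y : RG 𝒞} (φ : X ⟶ Y) : X.kite ⟶ Y.kite where
  hSpan := Span.Hom.mk (S := X.span) (T := Y.span) (Hom.f₁ φ) (Hom.f₀ φ) (Hom.f₀ φ)
    (Hom.d_comm φ) (Hom.c_comm φ)
  hA := Hom.f₁ φ
  hB := Hom.f₀ φ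
  hC := Hom.f₁ φ
  f_comm := (Hom.d_comm φ).symm
  r_comm := Hom.e_comm φ
  g_comm := (Hom.c_comm φ).symm
  s_comm := Hom.e_comm φ
  α_comm := (Category.id_comp _).trans (Category.comp_id _).symm
  β_comm := Hom.e_comm φ
  γ_comm := (Category.id_comp _).trans (Category.comp_id _).symm

end

section

variable {𝒞 : Type u} [Category.{v} 𝒞] [HasLocalProducts 𝒞]

/-! ### From pregroupoids to groupoids -/

/-- The kite which expresses the associativity of a pregroupoid structure. -/
def Span.assocKite (S : Span 𝒞) {p : S.Kdc ⟶ S.D} (hp : S.IsPregroupoid p) : DiKite 𝒞 where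
  span := S
  f := S.lst
  r := S.triple (𝟙 _) (𝟙 _) (𝟙 _) rfl rfl
  g := S.fst
  s := S.triple (𝟙 _) (𝟙 _) (𝟙 _) rfl rfl
  α := p
  β := 𝟙 _
  γ := p
  r_f := S.triple_lst _ _ _ _ _
  s_g := S.triple_fst _ _ _ _ _
  r_α := hp.right _ _ _
  s_γ := hp.right _ _ _
  α_d := by rw [Category.id_comp, hp.p_d']
  γ_c := by rw [Category.id_comp, hp.p_c']

lemma Span.triple_congr (S : Span 𝒞) {Z : 𝒞} {x y z x' y' z' : Z ⟶ S.D}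
    (hx : x = x') (hy : y = y') (hz : z = z') (h : x ≫ S.d = y ≫ S.d) (h' : y ≫ S.c = z ≫ S.c) :
    S.triple x y z h h' = S.triple x' y' z' (by rw [← hx, ← hy, h]) (by rw [← hy, ← hz, h']) := by
  subst hx hy hz
  rfl

/-- `p(p(x, y, z), u, v) = p(x, y, p(z, u, v))`. -/
lemma Span.IsPregroupoid.assoc {M : ObjectProperty (Span 𝒞)} (hM : HasUniqueKiteMul M)
    {S : Span 𝒞} (hS : M S) {p : S.Kdc ⟶ S.D} (hp : S.IsPregroupoid p)
    {Z : 𝒞} (x y z u v : Z ⟶ S.D) (h₁ : x ≫ S.d = y ≫ S.d) (h₂ : y ≫ S.c = z ≫ S.c)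
    (h₃ : z ≫ S.d = u ≫ S.d) (h₄ : u ≫ S.c = v ≫ S.c) :
    S.triple (S.triple x y z h₁ h₂ ≫ p) u v ((hp.triple_d _ _ _ _ _).trans h₃) h₄ ≫ p =
      S.triple x y (S.triple z u v h₃ h₄ ≫ p) h₁ (h₂.trans (hp.triple_c _ _ _ _ _).symm) ≫ p := by
  -- The local product of `assocKite` consists of the tuples (x, y, z, u, v), split as (x, y, z) and
  -- (z, u, v); `ext` is the uniqueness of its multiplication.
  obtain ⟨P, t, t', e₁, e₂, H, ext⟩ : ∃ (P : 𝒞) (t t' : P ⟶ S.Kdc) (e₁ e₂ : S.Kdc ⟶ P),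
      IsLocalProductSquare S.lst (S.triple (𝟙 _) (𝟙 _) (𝟙 _) rfl rfl) S.fst
        (S.triple (𝟙 _) (𝟙 _) (𝟙 _) rfl rfl) t e₁ t' e₂ ∧
      ∀ m n : P ⟶ S.D,
        (m ≫ S.d = t' ≫ p ≫ S.d ∧ m ≫ S.c = t ≫ p ≫ S.c ∧ e₁ ≫ m = p ∧ e₂ ≫ m = p) →
        (n ≫ S.d = t' ≫ p ≫ S.d ∧ n ≫ S.c = t ≫ p ≫ S.c ∧ e₁ ≫ n = p ∧ e₂ ≫ n = p) → m = n :=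
    let K := S.assocKite hp
    ⟨K.P, K.π₁, K.π₂, K.e₁, K.e₂, K.isLocalProductSquare, fun m n hm hn =>
      (hM K hS).unique ⟨hm.1, hm.2.1, hm.2.2.1, hm.2.2.2⟩ ⟨hn.1, hn.2.1, hn.2.2.1, hn.2.2.2⟩⟩
  have w := H.isPullback.w
  have a₁ := H.e₁_p₁
  have a₂ := H.e₁_p₂
  have b₁ := H.e₂_p₁
  have b₂ := H.e₂_p₂
  have hl₁ : (t ≫ p) ≫ S.d = (t' ≫ S.mid) ≫ S.d := by
    rw [Category.assoc, Category.assoc, hp.p_d', ← S.fst_d, reassoc_of% w]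
  have hl₂ : (t' ≫ S.mid) ≫ S.c = (t' ≫ S.lst) ≫ S.c := by
    rw [Category.assoc, Category.assoc, S.mid_c]
  have hr₁ : (t ≫ S.fst) ≫ S.d = (t ≫ S.mid) ≫ S.d := by
    rw [Category.assoc, Category.assoc, S.fst_d]
  have hr₂ : (t ≫ S.mid) ≫ S.c = (t' ≫ p) ≫ S.c := by
    rw [Category.assoc, Category.assoc, hp.p_c', S.mid_c, reassoc_of% w]
  -- Both bracketings are multiplications on this kite: on (x, y, z, z, z) each gives p(x, y, z),
  -- and on (z, z, z, u, v) each gives p(z, u, v).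
  have key : S.triple _ _ _ hl₁ hl₂ ≫ p = S.triple _ _ _ hr₁ hr₂ ≫ p := by
    apply ext
    all_goals
      refine ⟨(hp.triple_d _ _ _ _ _).trans ?_, (hp.triple_c _ _ _ _ _).trans ?_, ?_, ?_⟩
    · rw [hp.p_d', Category.assoc]
    · exact Category.assoc _ _ _
    · rw [← Category.assoc, S.comp_triple, S.triple_congr (x' := p) (y' := S.lst) (z' := S.lst)]
      · exact hp.right _ _ _
      · rw [reassoc_of% a₁]
      · rw [reassoc_of% a₂, S.triple_mid, Category.comp_id]
      · rw [reassoc_of% a₂, S.triple_lst, Category.comp_id]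
    · rw [← Category.assoc, S.comp_triple, S.triple_congr (x' := S.fst) (y' := S.mid) (z' := S.lst)]
      · rw [S.triple_components, Category.id_comp]
      · rw [reassoc_of% b₁, hp.right, Category.comp_id]
      · rw [reassoc_of% b₂]
      · rw [reassoc_of% b₂]
    · exact Category.assoc _ _ _
    · rw [hp.p_c', Category.assoc]
    · rw [← Category.assoc, S.comp_triple, S.triple_congr (x' := S.fst) (y' := S.mid) (z' := S.lst)]
      · rw [S.triple_components, Category.id_comp]
      · rw [reassoc_of% a₁]
      · rw [reassoc_of% a₁]
      · rw [reassoc_of% a₂, hp.right, Category.comp_id]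
    · rw [← Category.assoc, S.comp_triple, S.triple_congr (x' := S.fst) (y' := S.fst) (z' := p)]
      · exact hp.left _ _ _
      · rw [reassoc_of% b₁, S.triple_fst, Category.comp_id]
      · rw [reassoc_of% b₁, S.triple_mid, Category.comp_id]
      · rw [reassoc_of% b₂]
  let k : Z ⟶ P := H.isPullback.lift (S.triple x y z h₁ h₂) (S.triple z u v h₃ h₄)
    ((S.triple_lst _ _ _ _ _).trans (S.triple_fst _ _ _ _ _).symm)
  have k₁ : k ≫ t = S.triple x y z h₁ h₂ := H.isPullback.lift_fst _ _ _
  have k₂ : k ≫ t' = S.triple z u v h₃ h₄ := H.isPullback.lift_snd _ _ _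
  have key' := k ≫= key
  rw [← Category.assoc, ← Category.assoc, S.comp_triple, S.comp_triple] at key'
  rw [S.triple_congr (x := k ≫ t ≫ p) (x' := S.triple x y z h₁ h₂ ≫ p) (y' := u) (z' := v),
    S.triple_congr (x := k ≫ t ≫ S.fst) (x' := x) (y' := y)
      (z' := S.triple z u v h₃ h₄ ≫ p)] at key'
  · exact key'
  · rw [reassoc_of% k₁, S.triple_fst]
  · rw [reassoc_of% k₁, S.triple_mid]
  · rw [reassoc_of% k₂]
  · rw [reassoc_of% k₁]
  · rw [reassoc_of% k₂, S.triple_mid]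
  · rw [reassoc_of% k₂, S.triple_lst]

/-- An associative natural ternary operation on the arrows of a reflexive graph gives
an internal groupoid, with `x y = t(x, 1, y)` and `x⁻¹ = t(1, x, 1)`. -/
lemma RG.exists_groupoid_of_ternary (X : RG 𝒞)
    (t : ∀ {Z : 𝒞} (x y z : Z ⟶ X.C₁), x ≫ X.d = y ≫ X.d → y ≫ X.c = z ≫ X.c → (Z ⟶ X.C₁))
    (comp : ∀ {W Z : 𝒞} (w : W ⟶ Z) (x y z : Z ⟶ X.C₁) (h : x ≫ X.d = y ≫ X.d)
      (h' : y ≫ X.c = z ≫ X.c),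
      w ≫ t x y z h h' = t (w ≫ x) (w ≫ y) (w ≫ z) (by simp [h]) (by simp [h']))
    (right : ∀ {Z : 𝒞} (x y : Z ⟶ X.C₁) (h : x ≫ X.d = y ≫ X.d), t x y y h rfl = x)
    (left : ∀ {Z : 𝒞} (y z : Z ⟶ X.C₁) (h : y ≫ X.c = z ≫ X.c), t y y z rfl h = z)
    (td : ∀ {Z : 𝒞} (x y z : Z ⟶ X.C₁) (h : x ≫ X.d = y ≫ X.d)
      (h' : y ≫ X.c = z ≫ X.c), t x y z h h' ≫ X.d = z ≫ X.d)
    (tc : ∀ {Z : 𝒞} (x y z : Z ⟶ X.C₁) (h : x ≫ X.d = y ≫ X.d)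
      (h' : y ≫ X.c = z ≫ X.c), t x y z h h' ≫ X.c = x ≫ X.c)
    (assoc : ∀ {Z : 𝒞} (x y z u v : Z ⟶ X.C₁) (h₁ : x ≫ X.d = y ≫ X.d) (h₂ : y ≫ X.c = z ≫ X.c)
      (h₃ : z ≫ X.d = u ≫ X.d) (h₄ : u ≫ X.c = v ≫ X.c),
      t (t x y z h₁ h₂) u v ((td _ _ _ _ _).trans h₃) h₄ =
        t x y (t z u v h₃ h₄) h₁ (h₂.trans (tc _ _ _ _ _).symm)) :
    ∃ U : UMG 𝒞, U.graph = X ∧ U.IsAssociative ∧ U.HasInverses := by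
  have congr : ∀ {Z : 𝒞} {x y z x' y' z' : Z ⟶ X.C₁} (hx : x = x') (hy : y = y') (hz : z = z')
      (h : x ≫ X.d = y ≫ X.d) (h' : y ≫ X.c = z ≫ X.c),
      t x y z h h' = t x' y' z' (by rw [← hx, ← hy, h]) (by rw [← hy, ← hz, h']) := by
    rintro Z x y z _ _ _ rfl rfl rfl h h'
    rfl
  have hd : ∀ {Z : 𝒞} (x : Z ⟶ X.C₁), x ≫ X.d = (x ≫ X.d ≫ X.e) ≫ X.d := by
    intro Z x
    simp [X.e_d]
  have hc : ∀ {Z : 𝒞} (x y : Z ⟶ X.C₁), x ≫ X.d = y ≫ X.c →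
      (x ≫ X.d ≫ X.e) ≫ X.c = y ≫ X.c := by
    intro Z x y h
    simp [X.e_c, h]
  let m : X.C₂ ⟶ X.C₁ := t X.π₁ (X.π₁ ≫ X.d ≫ X.e) X.π₂ (hd _) (hc _ _ pullback.condition)
  have hm : ∀ {Z : 𝒞} (x y : Z ⟶ X.C₁) (h : x ≫ X.d = y ≫ X.c),
      pullback.lift x y h ≫ m = t x (x ≫ X.d ≫ X.e) y (hd _) (hc _ _ h) := by
    intro Z x y h
    rw [comp]
    apply congr
    · exact pullback.lift_fst _ _ _
    · rw [pullback.lift_fst_assoc]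
    · exact pullback.lift_snd _ _ _
  let U : UMG 𝒞 :=
    { graph := X
      m := m
      m_d := td _ _ _ _ _
      m_c := tc _ _ _ _ _
      e₁_m := by
        rw [RG.e₁, hm, congr rfl (y' := X.d ≫ X.e) (z' := X.d ≫ X.e), right]
        · simp
        · rfl
      e₂_m := by
        rw [RG.e₂, hm, congr rfl (y' := X.c ≫ X.e) (z' := 𝟙 _), left]
        · simp [reassoc_of% X.e_d]
        · rfl }
  have mul : ∀ {Z : 𝒞} (x y : Z ⟶ X.C₁) (h : x ≫ X.d = y ≫ X.c),
      U.mul x y h = t x (x ≫ X.d ≫ X.e) y (hd _) (hc _ _ h) := hm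
  refine ⟨U, rfl, fun Z x y z hxy hyz => ?_, ?_⟩
  · refine (mul _ _ _).trans (Eq.trans ?_ (mul _ _ _).symm)
    -- The identity in the outer product of (xy)z sits at d(xy) = dy, so this is t(t(x, 1, y), 1,
    -- z), to which `assoc` applies.
    refine (congr (mul x y hxy) (y' := y ≫ X.d ≫ X.e) ?_ rfl _ _).trans
      (Eq.trans (assoc _ _ _ _ _ _ _ (hd _) (hc _ _ hyz)) ?_)
    · rw [mul x y hxy, ← Category.assoc, td, Category.assoc]
    · exact congr rfl rfl (mul y z hyz).symm _ _
  · have h₁ : (X.d ≫ X.e) ≫ X.d = 𝟙 _ ≫ X.d := by simp [X.e_d]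
    have h₂ : 𝟙 _ ≫ X.c = (X.c ≫ X.e) ≫ X.c := by simp [X.e_c]
    let i : X.C₁ ⟶ X.C₁ := t (X.d ≫ X.e) (𝟙 _) (X.c ≫ X.e) h₁ h₂
    have id : i ≫ X.d = X.c := by rw [td, Category.assoc, X.e_d, Category.comp_id]
    have ic : i ≫ X.c = X.d := by rw [tc, Category.assoc, X.e_c, Category.comp_id]
    refine ⟨i, id, ic, ?_, ?_⟩
    · refine (mul _ _ _).trans ?_
      refine (congr rfl (Category.id_comp _) rfl _ _).trans ?_
      -- With 1 the identity at dx and 1' that at cx: x·i(x) = t(x, 1, t(1, x, 1')) = t(t(x, 1, 1),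
      -- x, 1') = t(x, x, 1') = 1'.
      refine (assoc (𝟙 _) (X.d ≫ X.e) (X.d ≫ X.e) (𝟙 _) (X.c ≫ X.e) h₁.symm rfl h₁ h₂).symm.trans ?_
      exact (congr (right _ _ _) rfl rfl _ _).trans (left _ _ _)
    · refine (mul _ _ _).trans ?_
      refine (congr rfl (y' := X.c ≫ X.e) (by rw [reassoc_of% id]) rfl _ _).trans ?_
      -- Likewise i(x)·x = t(t(1, x, 1'), 1', x) = t(1, x, t(1', 1', x)) = t(1, x, x) = 1.
      refine (assoc (X.d ≫ X.e) (𝟙 _) (X.c ≫ X.e) (X.c ≫ X.e) (𝟙 _) h₁ h₂ rfl h₂.symm).trans ?_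
      exact (congr rfl rfl (left _ _ _) _ _).trans (right _ _ _)

variable {M : ObjectProperty (Span 𝒞)}

lemma HasUniqueKiteMul.exists_groupoid (h : HasUniqueKiteMul M) (X : RG 𝒞) (hX : M X.span) :
    ∃ U : UMG 𝒞, U.graph = X ∧ U.IsAssociative ∧ U.HasInverses := by
  obtain ⟨p, hp⟩ := (h X.span.kite hX).exists
  replace hp : X.span.IsPregroupoid p := (X.span.isMul_kite_iff p).1 hp
  refine X.exists_groupoid_of_ternary (fun x y z h h' => X.span.triple x y z h h' ≫ p)
    ?_ hp.right hp.left hp.triple_d hp.triple_c (hp.assoc h hX)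
  intro W Z w x y z h h'
  refine (Category.assoc _ _ _).symm.trans ?_
  exact congrArg (· ≫ p) (X.span.comp_triple w x y z h h')

/-! ### The forgetful functors as isomorphisms -/

lemma UMG.isMul (U : UMG 𝒞) : U.graph.IsMul U.m := ⟨U.m_d, U.m_c, U.e₁_m, U.e₂_m⟩

/-- Unital multiplications on a reflexive graph are the multiplications on its kite `RG.kite`, and
these are unique. -/
lemma HasUniqueKiteMul.umg_ext (h : HasUniqueKiteMul M) {U V : UMG 𝒞} (hU : M U.graph.span)
    (e : U.graph = V.graph) : U = V := by
  have hU' := U.isMul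
  have hV' := V.isMul
  obtain ⟨X, m, _, _, _, _⟩ := U
  obtain ⟨Y, n, _, _, _, _⟩ := V
  obtain rfl : X = Y := e
  obtain rfl : m = n :=
    (h X.kite hU).unique ((X.isMul_kite_iff m).2 hU') ((X.isMul_kite_iff n).2 hV')
  rfl

lemma HasUniqueKiteMul.umg_full (h : HasUniqueKiteMul M) {U V : UMG 𝒞} (hV : M V.graph.span)
    (φ : U.graph ⟶ V.graph) : U.m ≫ RG.Hom.f₁ φ = RG.Hom.f₂ φ ≫ V.m :=
  h.natural hV ((U.graph.isMul_kite_iff _).2 U.isMul) ((V.graph.isMul_kite_iff _).2 V.isMul)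
    (RG.kiteMap φ)

lemma HasUniqueKiteMul.isIso_umg (h : HasUniqueKiteMul M) :
    IsIsoOfCategories (restrict (UMG.forget 𝒞) (graphsIn M)) := by
  refine isIsoOfCategories_restrict _ _ (fun X hX => ?_) (fun U V hU e => h.umg_ext hU e)
    (fun U V hU hV φ => ⟨⟨φ, h.umg_full hV φ⟩, rfl⟩)
  obtain ⟨U, hU, -⟩ := h.exists_groupoid X hX
  exact ⟨U, hU⟩

/-- Covers categories and groupoids at once: the structure found on a graph is always a groupoid. -/
lemma HasUniqueKiteMul.isIso_fullSubcategory (h : HasUniqueKiteMul M)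
    (Q : ObjectProperty (UMG 𝒞)) (hQ : ∀ U : UMG 𝒞, U.IsAssociative → U.HasInverses → Q U) :
    IsIsoOfCategories (restrict (Q.ι ⋙ UMG.forget 𝒞) (graphsIn M)) := by
  refine isIsoOfCategories_restrict _ _ (fun X hX => ?_)
    (fun U V hU e => ObjectProperty.FullSubcategory.ext (h.umg_ext hU e))
    (fun U V hU hV φ => ⟨ObjectProperty.homMk ⟨φ, h.umg_full hV φ⟩, rfl⟩)
  obtain ⟨U, hU, ha, hi⟩ := h.exists_groupoid X hX
  exact ⟨⟨U, hQ U ha hi⟩, hU⟩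

lemma HasUniqueKiteMul.isIso_preGrpd (h : HasUniqueKiteMul M) :
    IsIsoOfCategories (restrict (PreGrpd.forget 𝒞) M) := by
  have isMul : ∀ U : PreGrpd 𝒞, U.span.kite.IsMul U.p := fun U =>
    (U.span.isMul_kite_iff _).2 ⟨U.e₁_p, U.e₂_p, U.p_d, U.p_c⟩
  refine isIsoOfCategories_restrict _ _ (fun S hS => ?_) (fun U V hU e => ?_)
    (fun U V hU hV φ => ⟨⟨φ, h.natural hV (isMul U) (isMul V) (Span.kiteMap φ)⟩, rfl⟩)
  · obtain ⟨p, hp⟩ := (h S.kite hS).exists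
    have hp' := (S.isMul_kite_iff p).1 hp
    exact ⟨⟨S, p, hp'.e₁_p, hp'.e₂_p, hp'.p_d, hp'.p_c⟩, rfl⟩
  · have hU' := isMul U
    have hV' := isMul V
    obtain ⟨S, p, _, _, _, _⟩ := U
    obtain ⟨T, q, _, _, _, _⟩ := V
    obtain rfl : S = T := e
    obtain rfl : p = q := (h S.kite hU).unique hU' hV'
    rfl

lemma HasUniqueKiteMul.isIso_mKite (h : HasUniqueKiteMul M) :
    IsIsoOfCategories (restrict (MKite.forget 𝒞) (kitesIn M)) := by
  have isMul : ∀ U : MKite 𝒞, U.kite.IsMul U.m := fun U => ⟨U.m_d, U.m_c, U.e₁_m, U.e₂_m⟩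
  refine isIsoOfCategories_restrict _ _ (fun K hK => ?_) (fun U V hU e => ?_)
    (fun U V hU hV φ => ⟨⟨φ, h.natural hV (isMul U) (isMul V) φ⟩, rfl⟩)
  · obtain ⟨m, hm⟩ := (h K hK).exists
    exact ⟨⟨K, m, hm.m_d, hm.m_c, hm.e₁_m, hm.e₂_m⟩, rfl⟩
  · have hU' := isMul U
    have hV' := isMul V
    obtain ⟨K, m, _, _, _, _⟩ := U
    obtain ⟨L, n, _, _, _, _⟩ := V
    obtain rfl : K = L := e
    obtain rfl : m = n := (h K hU).unique hU' hV'
    rfl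

/-! ### The unification of the conditions -/

lemma unificationConditions_iff (hM : IsAdequate M) :
    ∀ P ∈ unificationConditions M, (P ↔ HasNaturalPregroupoids M) := by
  have kc : HasNaturalPregroupoids M → KiteCondition M := fun h => h.kiteCondition hM.swap
  have uk : HasNaturalPregroupoids M → HasUniqueKiteMul M := fun h => (kc h).hasUniqueKiteMul hM
  have ku : HasUniqueKiteMul M → HasNaturalPregroupoids M :=
    fun h => h.hasNaturalKiteMul.hasNaturalPregroupoids
  have graphs : HasLifts (UMG.forget 𝒞) (graphsIn M) → HasNaturalPregroupoids M :=
    fun h => (hasNaturalMul_of_hasLifts h).hasNaturalPregroupoids hM.graph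
  have grpd : HasSection (restrict (InternalGrpd.forget 𝒞) (graphsIn M)) →
      HasNaturalPregroupoids M := fun h => graphs (HasSection.hasLifts h).of_comp
  have cat : HasSection (restrict (InternalCat.forget 𝒞) (graphsIn M)) →
      HasNaturalPregroupoids M := fun h => graphs (HasSection.hasLifts h).of_comp
  have umg : HasSection (restrict (UMG.forget 𝒞) (graphsIn M)) →
      HasNaturalPregroupoids M := fun h => graphs h.hasLifts
  have pre : HasSection (restrict (PreGrpd.forget 𝒞) M) →
      HasNaturalPregroupoids M := fun h => hasNaturalPregroupoids_of_hasLifts h.hasLifts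
  have kite : HasSection (restrict (MKite.forget 𝒞) (kitesIn M)) →
      HasNaturalPregroupoids M :=
    fun h => (hasNaturalKiteMul_of_hasLifts h.hasLifts).hasNaturalPregroupoids
  have grpd' : HasNaturalPregroupoids M →
      IsIsoOfCategories (restrict (InternalGrpd.forget 𝒞) (graphsIn M)) :=
    fun h => (uk h).isIso_fullSubcategory (isInternalGrpd 𝒞) fun U ha hi => ⟨ha, hi⟩
  have cat' : HasNaturalPregroupoids M →
      IsIsoOfCategories (restrict (InternalCat.forget 𝒞) (graphsIn M)) :=
    fun h => (uk h).isIso_fullSubcategory (isInternalCat 𝒞) fun U ha _ => ha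
  simp only [unificationConditions, List.mem_cons, List.not_mem_nil, or_false, forall_eq_or_imp,
    forall_eq]
  exact ⟨⟨fun h => grpd h.hasSection, grpd'⟩, ⟨grpd, fun h => (grpd' h).hasSection⟩,
    ⟨fun h => cat h.hasSection, cat'⟩, ⟨cat, fun h => (cat' h).hasSection⟩,
    ⟨fun h => umg h.hasSection, fun h => (uk h).isIso_umg⟩,
    ⟨umg, fun h => (uk h).isIso_umg.hasSection⟩,
    ⟨fun h => pre h.hasSection, fun h => (uk h).isIso_preGrpd⟩,
    ⟨pre, fun h => (uk h).isIso_preGrpd.hasSection⟩,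
    ⟨fun h => kite h.hasSection, fun h => (uk h).isIso_mKite⟩,
    ⟨kite, fun h => (uk h).isIso_mKite.hasSection⟩,
    ⟨fun h => ku (h.hasUniqueKiteMul hM), kc⟩⟩

end

/-- A list of propositions each of which is equivalent to `q` is `TFAE`. -/
lemma tfae_of_forall_iff {l : List Prop} (q : Prop) (h : ∀ P ∈ l, (P ↔ q)) : l.TFAE :=
  fun a ha b hb => (h a ha).trans (h b hb).symm

section

variable {𝒞 : Type u} [Category.{v} 𝒞]

/-! ### The three classes of spans -/

/-- Only existence of a diagonal matters: a morphism is determined by its composites with the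
jointly epic test pair. -/
lemma jointlyStronglyMonic_of_exists {D D₀ D₁ : 𝒞} {d : D ⟶ D₀} {c : D ⟶ D₁}
    (h : ∀ ⦃X₁ X₂ Y : 𝒞⦄ (e₁ : X₁ ⟶ Y) (e₂ : X₂ ⟶ Y), JointlyEpic e₁ e₂ →
      ∀ (f₁ : X₁ ⟶ D) (f₂ : X₂ ⟶ D) (g₀ : Y ⟶ D₀) (g₁ : Y ⟶ D₁),
        f₁ ≫ d = e₁ ≫ g₀ → f₁ ≫ c = e₁ ≫ g₁ → f₂ ≫ d = e₂ ≫ g₀ → f₂ ≫ c = e₂ ≫ g₁ →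
        ∃ m : Y ⟶ D, e₁ ≫ m = f₁ ∧ e₂ ≫ m = f₂ ∧ m ≫ d = g₀ ∧ m ≫ c = g₁) :
    JointlyStronglyMonic d c := by
  intro X₁ X₂ Y e₁ e₂ he f₁ f₂ g₀ g₁ h₁ h₂ h₃ h₄
  obtain ⟨m, hm⟩ := h e₁ e₂ he f₁ f₂ g₀ g₁ h₁ h₂ h₃ h₄
  exact ⟨m, hm, fun n hn => he _ _ (hn.1.trans hm.1.symm) (hn.2.1.trans hm.2.1.symm)⟩

variable [HasLocalProducts 𝒞]

lemma isAdequate_M₀ : IsAdequate (M₀ 𝒞) :=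
  ⟨fun _ _ => trivial, fun _ _ => trivial, fun _ _ _ _ _ _ _ _ _ _ _ _ _ => trivial⟩

/-- The middle entry y of a triple (x, y, z) is determined by dy = dx and cy = cz. -/
lemma Span.jointlyMonic_graph {S : Span 𝒞} (hS : JointlyMonic S.d S.c) :
    JointlyMonic S.fst S.lst := by
  intro Z x y h₁ h₂
  refine triple_hom_ext h₁ (hS _ _ ?_ ?_) h₂
  · rw [Category.assoc, Category.assoc, ← S.fst_d, reassoc_of% h₁]
  · rw [Category.assoc, Category.assoc, S.mid_c, reassoc_of% h₂]

lemma isAdequate_M₁ : IsAdequate (M₁ 𝒞) where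
  swap _ hS _ x y h₁ h₂ := hS x y h₂ h₁
  graph _ hS := Span.jointlyMonic_graph hS
  localProduct _ _ _ _ _ _ _ _ _ _ _ _ H _ _ _ h₁ h₂ := H.isPullback.hom_ext h₁ h₂

omit [HasLocalProducts 𝒞] in
-- The pair (g₀, g₁) factors through the pullback because its compatibility over B can be checked on
-- the jointly epic pair.
lemma IsLocalProductSquare.jointlyStronglyMonic {A B C E : 𝒞} {f : A ⟶ B} {r : B ⟶ A}
    {g : C ⟶ B} {s : B ⟶ C} {p₁ : E ⟶ A} {e₁ : A ⟶ E} {p₂ : E ⟶ C} {e₂ : C ⟶ E}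
    (H : IsLocalProductSquare f r g s p₁ e₁ p₂ e₂) : JointlyStronglyMonic p₁ p₂ := by
  apply jointlyStronglyMonic_of_exists
  intro X₁ X₂ Y a₁ a₂ ha f₁ f₂ g₀ g₁ h₁ h₂ h₃ h₄
  have w := H.isPullback.w
  refine ⟨H.isPullback.lift g₀ g₁ (ha _ _ ?_ ?_), ?_, ?_, ?_, ?_⟩
  · rw [← reassoc_of% h₁, ← reassoc_of% h₂, w]
  · rw [← reassoc_of% h₃, ← reassoc_of% h₄, w]
  · apply H.isPullback.hom_ext <;> simp [h₁, h₂]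
  · apply H.isPullback.hom_ext <;> simp [h₃, h₄]
  · simp
  · simp

omit [HasLocalProducts 𝒞] in
lemma JointlyStronglyMonic.swap {D D₀ D₁ : 𝒞} {d : D ⟶ D₀} {c : D ⟶ D₁}
    (h : JointlyStronglyMonic d c) : JointlyStronglyMonic c d := by
  apply jointlyStronglyMonic_of_exists
  intro X₁ X₂ Y e₁ e₂ he f₁ f₂ g₀ g₁ h₁ h₂ h₃ h₄
  obtain ⟨m, ⟨k₁, k₂, k₃, k₄⟩, -⟩ := h e₁ e₂ he f₁ f₂ g₁ g₀ h₂ h₁ h₄ h₃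
  exact ⟨m, k₁, k₂, k₄, k₃⟩

/-- The outer entries of the diagonal are prescribed; orthogonality of the original span supplies
the middle one. -/
lemma Span.jointlyStronglyMonic_graph {S : Span 𝒞} (hS : JointlyStronglyMonic S.d S.c) :
    JointlyStronglyMonic S.fst S.lst := by
  apply jointlyStronglyMonic_of_exists
  intro X₁ X₂ Y e₁ e₂ he f₁ f₂ g₀ g₁ h₁ h₂ h₃ h₄
  have hf : ∀ {X : 𝒞} {e : X ⟶ Y} {f : X ⟶ S.Kdc}, f ≫ S.fst = e ≫ g₀ →
      (f ≫ S.mid) ≫ S.d = e ≫ g₀ ≫ S.d := by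
    intro X e f h
    rw [Category.assoc, ← S.fst_d, reassoc_of% h]
  have hl : ∀ {X : 𝒞} {e : X ⟶ Y} {f : X ⟶ S.Kdc}, f ≫ S.lst = e ≫ g₁ →
      (f ≫ S.mid) ≫ S.c = e ≫ g₁ ≫ S.c := by
    intro X e f h
    rw [Category.assoc, S.mid_c, reassoc_of% h]
  obtain ⟨y, ⟨k₁, k₂, k₃, k₄⟩, -⟩ := hS e₁ e₂ he (f₁ ≫ S.mid) (f₂ ≫ S.mid) (g₀ ≫ S.d) (g₁ ≫ S.c)
    (hf h₁) (hl h₂) (hf h₃) (hl h₄)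
  refine ⟨S.triple g₀ y g₁ k₃.symm k₄, ?_, ?_, S.triple_fst _ _ _ _ _, S.triple_lst _ _ _ _ _⟩
  · apply triple_hom_ext <;> simp [triple_fst, triple_mid, triple_lst, h₁, h₂, k₁]
  · apply triple_hom_ext <;> simp [triple_fst, triple_mid, triple_lst, h₃, h₄, k₂]

lemma isAdequate_M₂ : IsAdequate (M₂ 𝒞) where
  swap _ hS := JointlyStronglyMonic.swap hS
  graph _ hS := Span.jointlyStronglyMonic_graph hS
  localProduct _ _ _ _ _ _ _ _ _ _ _ _ H := H.jointlyStronglyMonic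

/-! ### Naturally Mal'tsev categories -/

variable (𝒞) in
-- The class `M₀` imposes no restriction, so the Lawvere condition is the first of its eleven
-- conditions.
lemma isNaturallyMaltsev_iff :
    IsNaturallyMaltsev 𝒞 ↔ HasNaturalPregroupoids (M₀ 𝒞) :=
  (isIsoOfCategories_restrict_iff _ (graphsIn (M₀ 𝒞)) fun _ => trivial).symm.trans
    (unificationConditions_iff isAdequate_M₀ _ (List.mem_cons_self ..))

/-- The span `1 ⟵ D ⟶ 1`. -/
abbrev terminalSpan [HasBinaryProducts 𝒞] [HasTerminal 𝒞] (D : 𝒞) : Span 𝒞 :=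
  have : HasPullback (terminal.from D) (terminal.from D) :=
    (IsPullback.of_isLimit_binaryFan_of_isTerminal (prodIsProd D D) terminalIsTerminal).hasPullback
  { d := terminal.from D, c := terminal.from D }

lemma hasNaturalMaltsevOperation_iff [HasBinaryProducts 𝒞] [HasTerminal 𝒞] :
    HasNaturalPregroupoids (M₀ 𝒞) ↔ HasNaturalMaltsevOperation 𝒞 := by
  constructor
  · rintro ⟨p, hp, nat⟩
    -- Over the terminal object the constraints on triples are void, so every triple in D × D × D is
    -- admissible.
    let q : ∀ D : 𝒞, D ⨯ (D ⨯ D) ⟶ (terminalSpan D).Kdc := fun D =>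
      (terminalSpan D).triple prod.fst (prod.snd ≫ prod.fst) (prod.snd ≫ prod.snd)
        (Subsingleton.elim _ _) (Subsingleton.elim _ _)
    refine ⟨fun D => q D ≫ p (terminalSpan D) trivial, fun D D' h => ?_, fun Z D x y => ⟨?_, ?_⟩⟩
    · let φ : terminalSpan D ⟶ terminalSpan D' := Span.Hom.mk (S := terminalSpan D)
        (T := terminalSpan D') h (𝟙 _) (𝟙 _) (Subsingleton.elim _ _) (Subsingleton.elim _ _)
      have key := nat _ _ trivial trivial φ
      rw [Category.assoc]
      refine Eq.trans ?_ (q D ≫= key).symm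
      rw [← Category.assoc, ← Category.assoc]
      congr 1
      rw [Span.triple_cube, Span.comp_triple]
      apply Span.triple_congr <;> simp [φ]
    · rw [← Category.assoc, Span.comp_triple]
      refine Eq.trans ?_ ((hp (terminalSpan D) trivial).right x y (Subsingleton.elim _ _))
      congr 1
      apply Span.triple_congr <;>
        simp [prod.lift_fst, prod.lift_snd, prod.lift_snd_assoc]
    · rw [← Category.assoc, Span.comp_triple]
      refine Eq.trans ?_ ((hp (terminalSpan D) trivial).left x y (Subsingleton.elim _ _))
      congr 1
      apply Span.triple_congr <;>
        simp [prod.lift_fst, prod.lift_snd, prod.lift_snd_assoc]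
  · rintro ⟨p, nat, hp⟩
    have nat' : ∀ {Z D D' : 𝒞} (x y z : Z ⟶ D) (h : D ⟶ D'),
        (prod.lift x (prod.lift y z) ≫ p D) ≫ h =
          prod.lift (x ≫ h) (prod.lift (y ≫ h) (z ≫ h)) ≫ p D' := by
      intro Z D D' x y z h
      rw [Category.assoc, ← nat h]
      simp
    refine ⟨fun S _ => prod.lift S.fst (prod.lift S.mid S.lst) ≫ p S.D, fun S _ => ?_,
      fun S T _ _ φ => ?_⟩
    · refine .of_components _ (fun x y h => ?_) (fun y z h => ?_) ?_ ?_
      · rw [← Category.assoc]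
        simp only [prod.comp_lift, Span.triple_fst, Span.triple_mid, Span.triple_lst]
        exact (hp x y).1
      · rw [← Category.assoc]
        simp only [prod.comp_lift, Span.triple_fst, Span.triple_mid, Span.triple_lst]
        exact (hp y z).2
      -- Naturality along d gives dp(x, y, z) = p(dx, dy, dz), where dx = dy; similarly for c, where
      -- cy = cz.
      · rw [nat', S.fst_d]
        exact (hp _ _).2
      · rw [nat', S.mid_c]
        exact (hp _ _).1
    · rw [nat', ← Category.assoc]
      congr 1
      have h₁ : Span.Hom.cube φ ≫ T.fst = S.fst ≫ Span.Hom.h φ := RG.Hom.d_comm (Span.graphMap φ)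
      have h₃ : Span.Hom.cube φ ≫ T.lst = S.lst ≫ Span.Hom.h φ := RG.Hom.c_comm (Span.graphMap φ)
      simp only [prod.comp_lift, h₁, h₃, Span.cube_mid]

/-- The pushout `Q` of `(r, s)` is the middle object of a span, to which the kite condition
applies. -/
lemma KiteCondition.localProductsAreLocalCoproducts (h : KiteCondition (M₀ 𝒞))
    (hpush : HasPushoutsOfSplitMonos 𝒞) : LocalProductsAreLocalCoproducts 𝒞 := by
  intro A B C E f r g s p₁ e₁ p₂ e₂ H
  have rf := H.r_f
  have sg := H.s_g
  have : HasPushout r s := hpush r s ⟨⟨⟨f, rf⟩⟩⟩ ⟨⟨⟨g, sg⟩⟩⟩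
  let i₁ : A ⟶ pushout r s := pushout.inl r s
  let i₂ : C ⟶ pushout r s := pushout.inr r s
  have hi : r ≫ i₁ = s ≫ i₂ := pushout.condition
  let d : pushout r s ⟶ C := pushout.desc (f ≫ s) (𝟙 C) (by rw [reassoc_of% rf, Category.comp_id])
  let c : pushout r s ⟶ A := pushout.desc (𝟙 A) (g ≫ r) (by rw [reassoc_of% sg, Category.comp_id])
  have i₁d : i₁ ≫ d = f ≫ s := pushout.inl_desc _ _ _
  have i₂d : i₂ ≫ d = 𝟙 C := pushout.inr_desc _ _ _
  have i₁c : i₁ ≫ c = 𝟙 A := pushout.inl_desc _ _ _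
  have i₂c : i₂ ≫ c = g ≫ r := pushout.inr_desc _ _ _
  have : IsSplitEpi d := ⟨⟨⟨i₂, i₂d⟩⟩⟩
  have : IsSplitEpi c := ⟨⟨⟨i₁, i₁c⟩⟩⟩
  have comm : r ≫ e₁ = s ≫ e₂ := by
    apply H.isPullback.hom_ext
    · rw [Category.assoc, Category.assoc, H.e₁_p₁, H.e₂_p₁, reassoc_of% sg, Category.comp_id]
    · rw [Category.assoc, Category.assoc, H.e₁_p₂, H.e₂_p₂, reassoc_of% rf, Category.comp_id]
  -- The legs d = [sf, 1] and c = [1, rg] are the composites of the comparison k from the pushout to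
  -- E with p₂ and p₁. The morphism m obtained here is the inverse of k.
  obtain ⟨m, ⟨hm₁, hm₂, hmd, hmc⟩, -⟩ := h.existsUnique isAdequate_M₀ H { d := d, c := c } trivial
    i₁ i₂ hi (by rw [i₁d, reassoc_of% rf]) (by rw [i₂c, reassoc_of% sg])
  dsimp only at m hm₁ hm₂ hmd hmc
  rw [i₂d, Category.comp_id] at hmd
  rw [i₁c, Category.comp_id] at hmc
  let k : pushout r s ⟶ E := pushout.desc e₁ e₂ comm
  have i₁k : i₁ ≫ k = e₁ := pushout.inl_desc _ _ _
  have i₂k : i₂ ≫ k = e₂ := pushout.inr_desc _ _ _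
  have kp₁ : k ≫ p₁ = c := by
    apply pushout.hom_ext
    · exact (by rw [reassoc_of% i₁k, H.e₁_p₁, i₁c] : i₁ ≫ k ≫ p₁ = i₁ ≫ c)
    · exact (by rw [reassoc_of% i₂k, H.e₂_p₁, i₂c] : i₂ ≫ k ≫ p₁ = i₂ ≫ c)
  have kp₂ : k ≫ p₂ = d := by
    apply pushout.hom_ext
    · exact (by rw [reassoc_of% i₁k, H.e₁_p₂, i₁d] : i₁ ≫ k ≫ p₂ = i₁ ≫ d)
    · exact (by rw [reassoc_of% i₂k, H.e₂_p₂, i₂d] : i₂ ≫ k ≫ p₂ = i₂ ≫ d)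
  have mk : m ≫ k = 𝟙 E := by
    apply H.isPullback.hom_ext
    · rw [Category.assoc, kp₁, hmc, Category.id_comp]
    · rw [Category.assoc, kp₂, hmd, Category.id_comp]
  have km : k ≫ m = 𝟙 _ := by
    apply pushout.hom_ext
    · exact (by rw [reassoc_of% i₁k, hm₁, Category.comp_id] : i₁ ≫ k ≫ m = i₁ ≫ 𝟙 _)
    · exact (by rw [reassoc_of% i₂k, hm₂, Category.comp_id] : i₂ ≫ k ≫ m = i₂ ≫ 𝟙 _)
  exact (IsPushout.of_hasPushout r s).of_iso' (Iso.refl _) (Iso.refl _) (Iso.refl _)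
    ⟨m, k, mk, km⟩ (by simp) (by simp) (by simpa using hm₁.symm) (by simpa using hm₂.symm)

/-- The multiplication must be the copairing [α, γ]; its equations for d and c are checked on the
pushout injections. -/
lemma LocalProductsAreLocalCoproducts.hasUniqueKiteMul
    (h : LocalProductsAreLocalCoproducts 𝒞) (M : ObjectProperty (Span 𝒞)) :
    HasUniqueKiteMul M := by
  intro K _
  have H := K.isLocalProductSquare
  have hP := h _ _ _ _ _ _ _ _ H
  have hβ : K.r ≫ K.α = K.s ≫ K.γ := K.r_α.trans K.s_γ.symm
  refine ⟨hP.desc K.α K.γ hβ, ⟨?_, ?_, hP.inl_desc _ _ _, hP.inr_desc _ _ _⟩, fun m hm => ?_⟩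
  · have e₁π₂ := H.e₁_p₂
    have e₂π₂ := H.e₂_p₂
    apply hP.hom_ext
    · rw [hP.inl_desc_assoc, K.α_d, reassoc_of% e₁π₂, reassoc_of% K.s_γ]
    · rw [hP.inr_desc_assoc, reassoc_of% e₂π₂]
  · have e₁π₁ := H.e₁_p₁
    have e₂π₁ := H.e₂_p₁
    apply hP.hom_ext
    · rw [hP.inl_desc_assoc, reassoc_of% e₁π₁]
    · rw [hP.inr_desc_assoc, K.γ_c, reassoc_of% e₂π₁, reassoc_of% K.r_α]
  · apply hP.hom_ext
    · rw [hP.inl_desc, hm.e₁_m]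
    · rw [hP.inr_desc, hm.e₂_m]

/-! ### Mal'tsev categories -/

/-- The symmetry of the graph of a jointly monic span provides the pregroupoid structure. -/
lemma IsMaltsev.hasNaturalPregroupoids (h : IsMaltsev 𝒞) : HasNaturalPregroupoids (M₁ 𝒞) := by
  choose i hid hic using fun (S : Span 𝒞) (hS : M₁ 𝒞 S) =>
    h S.graph (Span.jointlyMonic_graph hS)
  -- The symmetry sends (x, y, z) to some (z, w, x), so dw = dz and cw = cx, as required of p(x, y,
  -- z). Joint monicity of (d, c) then settles the unit laws and naturality.
  have hd : ∀ S hS, (i S hS ≫ S.mid) ≫ S.d = S.lst ≫ S.d := by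
    intro S hS
    rw [Category.assoc, ← S.fst_d, ← Category.assoc, hid]
  have hc : ∀ S hS, (i S hS ≫ S.mid) ≫ S.c = S.fst ≫ S.c := by
    intro S hS
    rw [Category.assoc, S.mid_c, ← Category.assoc, hic]
  refine ⟨fun S hS => i S hS ≫ S.mid, fun S hS => ?_, fun S T hS hT φ => hT _ _ ?_ ?_⟩
  · refine .of_components _ (fun x y h => hS _ _ ?_ ?_) (fun y z h => hS _ _ ?_ ?_)
      (hd S hS) (hc S hS)
    · rw [Category.assoc, hd, S.triple_lst_assoc, h]
    · rw [Category.assoc, hc, S.triple_fst_assoc]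
    · rw [Category.assoc, hd, S.triple_lst_assoc]
    · rw [Category.assoc, hc, S.triple_fst_assoc, h]
  · have h₃ : Span.Hom.cube φ ≫ T.lst = S.lst ≫ Span.Hom.h φ := RG.Hom.c_comm (Span.graphMap φ)
    have hS' := hd S hS
    have hT' := hd T hT
    simp only [Category.assoc] at hS' hT' ⊢
    rw [hT', Span.Hom.d_comm, reassoc_of% hS', reassoc_of% h₃, Span.Hom.d_comm]
  · have h₁ : Span.Hom.cube φ ≫ T.fst = S.fst ≫ Span.Hom.h φ := RG.Hom.d_comm (Span.graphMap φ)
    have hS' := hc S hS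
    have hT' := hc T hT
    simp only [Category.assoc] at hS' hT' ⊢
    rw [hT', Span.Hom.c_comm, reassoc_of% hS', reassoc_of% h₁, Span.Hom.c_comm]

/-- The inversion of the groupoid structure on the relation is its symmetry. -/
lemma HasUniqueKiteMul.isMaltsev (h : HasUniqueKiteMul (M₁ 𝒞)) : IsMaltsev 𝒞 := by
  intro X hX
  obtain ⟨U, rfl, -, i, hd, hc, -⟩ := h.exists_groupoid X hX
  exact ⟨i, hd, hc⟩

lemma KiteCondition.localProductsAreExtremal (h : KiteCondition (M₁ 𝒞)) :
    LocalProductsAreExtremal 𝒞 := by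
  rintro A C E p₁ e₁ p₂ e₂ ⟨B, f, r, g, s, H⟩ S hS α γ hα hγ
  have rf := H.r_f
  have sg := H.s_g
  have a₂ := H.e₁_p₂
  have b₁ := H.e₂_p₁
  rw [reassoc_of% a₂] at hα
  rw [reassoc_of% b₁] at hγ
  -- Extremality does not assume rα = sγ; joint monicity of the span recovers it from the two given
  -- equations.
  have hβ : r ≫ α = s ≫ γ := by
    apply hS
    · rw [Category.assoc, Category.assoc, hα, reassoc_of% rf]
    · rw [Category.assoc, Category.assoc, hγ, reassoc_of% sg]
  obtain ⟨m, ⟨h₁, h₂, hd, hc⟩, uniq⟩ := h.existsUnique isAdequate_M₁ H S hS α γ hβ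
    (by rw [reassoc_of% hβ, ← hα]) (by rw [← reassoc_of% hβ, ← hγ])
  exact ⟨m, ⟨hd, hc, h₁, h₂⟩, fun n hn => uniq n ⟨hn.2.2.1, hn.2.2.2, hn.1, hn.2.1⟩⟩

lemma LocalProductsAreExtremal.hasUniqueKiteMul (h : LocalProductsAreExtremal 𝒞) :
    HasUniqueKiteMul (M₁ 𝒞) := by
  intro K hK
  have H := K.isLocalProductSquare
  have a₂ := H.e₁_p₂
  have b₁ := H.e₂_p₁
  obtain ⟨m, ⟨hd, hc, h₁, h₂⟩, uniq⟩ := h _ _ _ _ ⟨_, _, _, _, _, H⟩ K.span hK K.α K.γ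
    (by rw [reassoc_of% a₂, reassoc_of% K.s_γ, K.α_d])
    (by rw [reassoc_of% b₁, reassoc_of% K.r_α, K.γ_c])
  exact ⟨m, ⟨hd, hc, h₁, h₂⟩, fun n hn => uniq n ⟨hn.m_d, hn.m_c, hn.e₁_m, hn.e₂_m⟩⟩

/-! ### Weakly Mal'tsev categories -/

/-- The multiplication is the diagonal filler given by orthogonality of the direction of the kite to
(e₁, e₂). -/
lemma IsWeaklyMaltsev.hasUniqueKiteMul (h : IsWeaklyMaltsev 𝒞) : HasUniqueKiteMul (M₂ 𝒞) := by
  intro K hK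
  have H := K.isLocalProductSquare
  have a₁ := H.e₁_p₁
  have a₂ := H.e₁_p₂
  have b₁ := H.e₂_p₁
  have b₂ := H.e₂_p₂
  obtain ⟨m, ⟨h₁, h₂, hd, hc⟩, uniq⟩ := hK K.e₁ K.e₂ (h _ _ _ _ ⟨_, _, _, _, _, H⟩) K.α K.γ
    (K.π₂ ≫ K.γ ≫ K.span.d) (K.π₁ ≫ K.α ≫ K.span.c)
    (by rw [reassoc_of% a₂, reassoc_of% K.s_γ, K.α_d])
    (by rw [reassoc_of% a₁])
    (by rw [reassoc_of% b₂])
    (by rw [reassoc_of% b₁, reassoc_of% K.r_α, K.γ_c])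
  exact ⟨m, ⟨hd, hc, h₁, h₂⟩, fun n hn => uniq n ⟨hn.e₁_m, hn.e₂_m, hn.m_d, hn.m_c⟩⟩

/-- Two morphisms which agree on `e₁` and `e₂` have an equalizer which is split by the kite
condition. -/
lemma KiteCondition.isWeaklyMaltsev [HasEqualizers 𝒞]
    (hker : HasKernelPairsOfEqualizerSplitEpi 𝒞) (h : KiteCondition (M₂ 𝒞)) :
    IsWeaklyMaltsev 𝒞 := by
  rintro A C E p₁ e₁ p₂ e₂ ⟨B, f, r, g, s, H⟩ Z x y hx hy
  have rf := H.r_f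
  have sg := H.s_g
  have a₁ := H.e₁_p₁
  have a₂ := H.e₁_p₂
  have b₁ := H.e₂_p₁
  have b₂ := H.e₂_p₂
  let k := equalizer.ι x y
  have := hker x y p₁ ⟨⟨⟨e₁, a₁⟩⟩⟩
  have := hker x y p₂ ⟨⟨⟨e₂, b₂⟩⟩⟩
  let S : Span 𝒞 := { d := equalizer.ι x y ≫ p₂, c := equalizer.ι x y ≫ p₁ }
  -- A diagonal into E exists because (p₂, p₁) is jointly strongly monic. It equalizes x and y since
  -- it does so on the jointly epic pair, and therefore lifts.
  have hS : M₂ 𝒞 S := by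
    apply jointlyStronglyMonic_of_exists
    intro X₁ X₂ Y u₁ u₂ hu f₁ f₂ g₀ g₁ h₁ h₂ h₃ h₄
    obtain ⟨m, ⟨k₁, k₂, k₃, k₄⟩, -⟩ := H.jointlyStronglyMonic.swap u₁ u₂ hu (f₁ ≫ k) (f₂ ≫ k) g₀ g₁
      ((Category.assoc _ _ _).trans h₁) ((Category.assoc _ _ _).trans h₂)
      ((Category.assoc _ _ _).trans h₃) ((Category.assoc _ _ _).trans h₄)
    have hm : m ≫ x = m ≫ y := by
      apply hu
      · rw [reassoc_of% k₁, reassoc_of% k₁, equalizer.condition]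
      · rw [reassoc_of% k₂, reassoc_of% k₂, equalizer.condition]
    refine ⟨equalizer.lift m hm, ?_, ?_, ?_, ?_⟩
    · apply equalizer.hom_ext
      rw [Category.assoc, equalizer.lift_ι, k₁]
    · apply equalizer.hom_ext
      rw [Category.assoc, equalizer.lift_ι, k₂]
    · exact (equalizer.lift_ι_assoc _ _ _).trans k₃
    · exact (equalizer.lift_ι_assoc _ _ _).trans k₄
  let α : A ⟶ equalizer x y := equalizer.lift e₁ hx
  let γ : C ⟶ equalizer x y := equalizer.lift e₂ hy
  have αk : α ≫ k = e₁ := equalizer.lift_ι _ _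
  have γk : γ ≫ k = e₂ := equalizer.lift_ι _ _
  have hβ : r ≫ α = s ≫ γ := by
    apply equalizer.hom_ext
    refine (Category.assoc _ _ _).trans (Eq.trans ?_ (Category.assoc _ _ _).symm)
    change r ≫ α ≫ k = s ≫ γ ≫ k
    rw [αk, γk]
    apply H.isPullback.hom_ext
    · rw [Category.assoc, Category.assoc, a₁, b₁, reassoc_of% sg, Category.comp_id]
    · rw [Category.assoc, Category.assoc, a₂, b₂, reassoc_of% rf, Category.comp_id]
  obtain ⟨m, ⟨-, -, hd, hc⟩, -⟩ := h.existsUnique isAdequate_M₂ H S hS α γ hβ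
    (by
      change α ≫ k ≫ p₂ = f ≫ r ≫ α ≫ k ≫ p₂
      rw [reassoc_of% αk, a₂, reassoc_of% rf])
    (by
      change γ ≫ k ≫ p₁ = g ≫ s ≫ γ ≫ k ≫ p₁
      rw [reassoc_of% γk, b₁, reassoc_of% sg])
  change m ≫ k ≫ p₂ = p₂ ≫ γ ≫ k ≫ p₂ at hd
  change m ≫ k ≫ p₁ = p₁ ≫ α ≫ k ≫ p₁ at hc
  rw [reassoc_of% γk, b₂, Category.comp_id] at hd
  rw [reassoc_of% αk, a₁, Category.comp_id] at hc
  -- With d = p₂k and c = p₁k, the equations for m say that km and 1 agree after p₁ and p₂. So the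
  -- equalizer k has a section, which forces x = y.
  have mk : m ≫ k = 𝟙 E := by
    apply H.isPullback.hom_ext
    · rw [Category.assoc, hc, Category.id_comp]
    · rw [Category.assoc, hd, Category.id_comp]
  have kxy : k ≫ x = k ≫ y := equalizer.condition x y
  rw [← Category.id_comp x, ← Category.id_comp y, ← mk, Category.assoc, Category.assoc, kxy]

end

end MaltsevType

end

theorem mainTheorem3 (𝒞 : Type u) [Category.{v} 𝒞] [MaltsevType.HasLocalProducts 𝒞] :
    -- (1) the naturally Mal'tsev case
    ((MaltsevType.IsNaturallyMaltsev 𝒞 ::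
        MaltsevType.unificationConditions (MaltsevType.M₀ 𝒞)).TFAE ∧
      (∀ [HasBinaryProducts 𝒞] [HasTerminal 𝒞],
        (MaltsevType.IsNaturallyMaltsev 𝒞 ↔ MaltsevType.HasNaturalMaltsevOperation 𝒞)) ∧
      (MaltsevType.HasPushoutsOfSplitMonos 𝒞 →
        (MaltsevType.IsNaturallyMaltsev 𝒞 ↔ MaltsevType.LocalProductsAreLocalCoproducts 𝒞))) ∧
    -- (2) the Mal'tsev case
    (MaltsevType.IsMaltsev 𝒞 :: MaltsevType.LocalProductsAreExtremal 𝒞 ::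
        MaltsevType.unificationConditions (MaltsevType.M₁ 𝒞)).TFAE ∧
    -- (3) the weakly Mal'tsev case
    (∀ [HasEqualizers 𝒞], MaltsevType.HasKernelPairsOfEqualizerSplitEpi 𝒞 →
      (MaltsevType.IsWeaklyMaltsev 𝒞 ::
        MaltsevType.unificationConditions (MaltsevType.M₂ 𝒞)).TFAE) := by
  open MaltsevType in
  refine ⟨⟨?_, ?_, fun hpush => ?_⟩, ?_, fun hker => ?_⟩
  · exact tfae_of_forall_iff _ (List.forall_mem_cons.2
      ⟨isNaturallyMaltsev_iff 𝒞, unificationConditions_iff isAdequate_M₀⟩)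
  · intro _ _
    exact (isNaturallyMaltsev_iff 𝒞).trans hasNaturalMaltsevOperation_iff
  · refine (isNaturallyMaltsev_iff 𝒞).trans ⟨fun h => ?_, fun h => ?_⟩
    · exact (h.kiteCondition isAdequate_M₀.swap).localProductsAreLocalCoproducts hpush
    · exact (h.hasUniqueKiteMul _).hasNaturalKiteMul.hasNaturalPregroupoids
  · refine tfae_of_forall_iff _ (List.forall_mem_cons.2 ⟨⟨fun h => h.hasNaturalPregroupoids,
      fun h => ?_⟩, List.forall_mem_cons.2 ⟨⟨fun h => ?_, fun h => ?_⟩,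
        unificationConditions_iff isAdequate_M₁⟩⟩)
    · exact ((h.kiteCondition isAdequate_M₁.swap).hasUniqueKiteMul isAdequate_M₁).isMaltsev
    · exact h.hasUniqueKiteMul.hasNaturalKiteMul.hasNaturalPregroupoids
    · exact (h.kiteCondition isAdequate_M₁.swap).localProductsAreExtremal
  · refine tfae_of_forall_iff _ (List.forall_mem_cons.2 ⟨⟨fun h => ?_, fun h => ?_⟩,
      unificationConditions_iff isAdequate_M₂⟩)
    · exact h.hasUniqueKiteMul.hasNaturalKiteMul.hasNaturalPregroupoids
    · exact (h.kiteCondition isAdequate_M₂.swap).isWeaklyMaltsev hker
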